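/- **Theorem (hyperbolic interpolation inequality).** Let $n\ge 5$ and $\kappa>0$. Let $\mathbb{H}^n_\kappa$ be the hyperbolic space of curvature $-\kappa^2$ in the ball model, i.e. $\{x\in\mathbb{R}^n:|x|<1\}$ with the metric $(g_\kappa)_{ij}=p_\kappa^2\delta_{ij}$, $p_\kappa(x)=\frac{2}{\kappa(1-|x|^2)}$, with volume $\mathrm{d}x_\kappa=p_\kappa^n\,\mathrm{d}x$, gradient $\nabla_\kappa u=p_\kappa^{-2}\nabla u$ and Laplace-Beltrami operator $\Delta_\kappa u=p_\kappa^{-n}\operatorname{div}(p_\kappa^{n-2}\nabla u)$. Let $\Omega\subseteq\mathbb{H}^n_\kappa$ be open, fix $x_0\in\Omega$, let $\rho(x)=d_\kappa(x_0,x)$ be the Riemannian distance from $x_0$, and put $\nabla^{\rm rad}_\kappa u=g_\kappa(\nabla_\kappa u,\nabla_\kappa\rho)$ and $\mathbf{ct}_\kappa(t)=\kappa\coth(\kappa t)$. Let $0\le\lambda\le\frac{(n-1)^2}{4}$, $\gamma_n(\lambda)=\sqrt{(n-1)^2-4\lambda}$ and $h_n(\lambda)=\frac{\gamma_n(\lambda)+1}{2}$.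 Then for every real-valued $u\in C_0^\infty(\Omega)$ all the integrals below converge, and $$\begin{aligned}\int_\Omega|\Delta_\kappa u|^2\,\mathrm{d}x_\kappa\ \ge\ {}&\kappa^2\lambda\int_\Omega|\nabla^{\rm rad}_\kappa u|^2\,\mathrm{d}x_\kappa+h_n(\lambda)^2\int_\Omega\frac{|\nabla^{\rm rad}_\kappa u|^2}{\rho^2}\,\mathrm{d}x_\kappa\\&+\kappa^2\Big(\frac{n^2}{4}-h_n(\lambda)^2\Big)\int_\Omega\frac{|\nabla^{\rm rad}_\kappa u|^2}{\sinh^2(\kappa\rho)}\,\mathrm{d}x_\kappa+\gamma_n(\lambda)h_n(\lambda)\int_\Omega\frac{\rho\,\mathbf{ct}_\kappa(\rho)-1}{\rho^2}\,|\nabla^{\rm rad}_\kappa u|^2\,\mathrm{d}x_\kappa.\end{aligned}$$ -/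

import Mathlib

open Set MeasureTheory Metric Gradient
open scoped ContDiff

noncomputable section

namespace HypSpace

/-- The ambient Euclidean space `ℝⁿ`. -/
abbrev E (n : ℕ) : Type := EuclideanSpace ℝ (Fin n)

/-- The underlying set of the hyperbolic space `ℍⁿ_κ`: the open Euclidean unit ball. -/
def space (n : ℕ) : Set (E n) := ball 0 1

/-- The conformal factor `p_κ(x) = 2 / (κ (1 - |x|²))`, for `κ > 0`. -/
def conf {n : ℕ} (κ : ℝ) (x : E n) : ℝ := 2 / (κ * (1 - ‖x‖ ^ 2))

/-- The Riemannian metric `g_κ(v, w) = p_κ(x)² v · w` on tangent vectors at `x`. -/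
def metric {n : ℕ} (κ : ℝ) (x v w : E n) : ℝ := conf κ x ^ 2 * inner ℝ v w

/-- The Riemannian norm `√(g_κ(v, v))` of a tangent vector at `x`. -/
def tangentNorm {n : ℕ} (κ : ℝ) (x v : E n) : ℝ := √(metric κ x v v)

/-- `γ` restricted to `[0, 1]` is a `C¹` curve in the hyperbolic space from `x` to `y`. -/
structure IsCurve {n : ℕ} (γ : ℝ → E n) (x y : E n) : Prop where
  contDiffOn : ContDiffOn ℝ 1 γ (Icc 0 1)
  mapsTo : MapsTo γ (Icc 0 1) (space n)
  source : γ 0 = x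
  target : γ 1 = y

/-- The Riemannian length of a curve parametrized by `[0, 1]`. -/
def curveLength {n : ℕ} (κ : ℝ) (γ : ℝ → E n) : ℝ :=
  ∫ t in (0 : ℝ)..1, tangentNorm κ (γ t) (derivWithin γ (Icc 0 1) t)

/-- The Riemannian distance `d_κ(x, y)`: the infimum of the lengths of the curves from `x` to
`y`. -/
def rdist {n : ℕ} (κ : ℝ) (x y : E n) : ℝ :=
  sInf {L | ∃ γ : ℝ → E n, IsCurve γ x y ∧ L = curveLength κ γ}

/-- The canonical volume measure `dx_κ = p_κⁿ dx` of the hyperbolic space. -/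
def vol (n : ℕ) (κ : ℝ) : Measure (E n) :=
  (volume.restrict (space n)).withDensity fun x => ENNReal.ofReal (conf κ x ^ n)

/-- The Riemannian gradient `∇_κ u = ∇u / p_κ²`. -/
def rgrad {n : ℕ} (κ : ℝ) (u : E n → ℝ) (x : E n) : E n := (conf κ x ^ 2)⁻¹ • ∇ u x

/-- The Euclidean divergence of a vector field. -/
def euclDiv {n : ℕ} (F : E n → E n) (x : E n) : ℝ :=
  ∑ i, fderiv ℝ F x (EuclideanSpace.single i 1) i

/-- The Laplace-Beltrami operator `Δ_κ u = p_κ⁻ⁿ div (p_κⁿ⁻² ∇u)`. -/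
def laplaceBeltrami {n : ℕ} (κ : ℝ) (u : E n → ℝ) (x : E n) : ℝ :=
  (conf κ x ^ n)⁻¹ * euclDiv (fun y => conf κ y ^ ((n : ℤ) - 2) • ∇ u y) x

/-- The radial derivative `⟨∇_κ u, ∇_κ d_{x₀}⟩` of `u` at `x`, where `d_{x₀} = d_κ(x₀, ·)`. -/
def radialDeriv {n : ℕ} (κ : ℝ) (x₀ : E n) (u : E n → ℝ) (x : E n) : ℝ :=
  metric κ x (rgrad κ u x) (rgrad κ (rdist κ x₀) x)

/-- The function `ct_κ(t) = κ coth(κ t)`, for `κ > 0`. -/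
def ct (κ t : ℝ) : ℝ := κ * (Real.cosh (κ * t) / Real.sinh (κ * t))

/-- `γ_n(λ) = √((n - 1)² - 4 λ)`. -/
def gam (n : ℕ) (lam : ℝ) : ℝ := √(((n : ℝ) - 1) ^ 2 - 4 * lam)

/-- `h_n(λ) = (γ_n(λ) + 1) / 2`. -/
def hCoef (n : ℕ) (lam : ℝ) : ℝ := (gam n lam + 1) / 2

/-- `u ∈ C₀^∞(Ω)`: the extension of `u` by zero to `ℝⁿ` is smooth, with compact support
contained in `Ω`. -/
structure IsTestFunction {n : ℕ} (Ω : Set (E n)) (u : E n → ℝ) : Prop where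
  contDiff : ContDiff ℝ ∞ u
  hasCompactSupport : HasCompactSupport u
  tsupport_subset : tsupport u ⊆ Ω

end HypSpace

end

noncomputable section

open Filter
open scoped Topology

namespace HypSpace

variable {n : ℕ}

/-! Put ψ = κρ and s = cosh ψ - 1. The Hessian of cosh ψ is κ² cosh ψ times the metric, so Y = ∇_κ
cosh ψ is a conformal field. For X = f(s) Y, the Rellich-Pohozaev field therefore has a divergence
in which second derivatives of u enter only through Δu ⟨X, ∇u⟩ (`euclDiv_rellichField`). This
divergence integrates to zero, so expanding (Δu - ⟨X, ∇u⟩)² ≥ 0 bounds ∫ |Δu|² below by a quadratic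
form in ∇u. If the coefficient of |∇u|² is nonnegative, |∇u|² may be replaced by its radial part
(`integral_radialDensity_le`). Writing X = κ Φ(ψ) ∂ᵣ, the resulting weight is the Riccati expression
κ² ((n - 1) Φ coth ψ - Φ' - Φ²).

The choice Φ = a coth ψ + h/ψ with h = h_n(λ) and a = n/2 - h produces exactly the four weights of
the theorem (`profileWeight_zero`), and tanh ψ ≤ ψ gives the required sign
(`profile_riccati_nonneg`). This Φ is singular at x₀, so f is evaluated at s + ε, and ε → 0 by
dominated convergence with a multiple of |x - x₀|⁻² as majorant
(`integral_radialDensity_mul_profileWeight_le`).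

Since ρ is an infimum of lengths, the explicit formula `rdist_eq` is needed first; it turns every
weight into a function of s. -/

/-! ### The gap function and its conformal gradient field -/

/-- `cosh (κ d_κ(y, x)) - 1` for points of the ball model. -/
def coshGap (y x : E n) : ℝ := 2 * ‖x - y‖ ^ 2 / ((1 - ‖x‖ ^ 2) * (1 - ‖y‖ ^ 2))

/-- The Riemannian gradient of `cosh (κ d_κ(y, ·))`, a conformal vector field. -/
def confField (κ : ℝ) (y x : E n) : E n :=
  (κ ^ 2 / (1 - ‖y‖ ^ 2)) •
    ((1 + ‖y‖ ^ 2) • x - (1 - ‖x‖ ^ 2) • y - (2 * inner ℝ x y) • x)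

lemma one_sub_norm_sq_pos {x : E n} (hx : x ∈ space n) : 0 < 1 - ‖x‖ ^ 2 := by
  have h : ‖x‖ < 1 := by simpa [space] using hx
  nlinarith [norm_nonneg x]

lemma mem_space_iff {x : E n} : x ∈ space n ↔ 0 < 1 - ‖x‖ ^ 2 := by
  refine ⟨one_sub_norm_sq_pos, fun h => ?_⟩
  have : ‖x‖ < 1 := by nlinarith [norm_nonneg x]
  simpa [space] using this

lemma isOpen_space : IsOpen (space n) := isOpen_ball

lemma conf_pos {κ : ℝ} (hκ : 0 < κ) {x : E n} (hx : x ∈ space n) : 0 < conf κ x := by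
  have := one_sub_norm_sq_pos hx
  unfold conf; positivity

lemma contDiffOn_conf {κ : ℝ} (hκ : 0 < κ) : ContDiffOn ℝ ∞ (conf (n := n) κ) (space n) := by
  unfold conf
  refine contDiffOn_const.div ?_ fun x hx => (mul_pos hκ (one_sub_norm_sq_pos hx)).ne'
  exact (contDiff_const.mul (contDiff_const.sub (contDiff_norm_sq ℝ))).contDiffOn

lemma norm_sub_sq_expand (x y : E n) :
    ‖x - y‖ ^ 2 = ‖x‖ ^ 2 - 2 * inner ℝ x y + ‖y‖ ^ 2 := norm_sub_sq_real x y

lemma coshGap_nonneg {x y : E n} (hx : x ∈ space n) (hy : y ∈ space n) : 0 ≤ coshGap y x := by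
  have h1 := one_sub_norm_sq_pos hx
  have h2 := one_sub_norm_sq_pos hy
  unfold coshGap; positivity

/-- Both factors of the denominator are at most 1. This is what compares the singular weights at y
with a Euclidean power. -/
lemma two_mul_norm_sub_sq_le_coshGap {x y : E n} (hx : x ∈ space n) (hy : y ∈ space n) :
    2 * ‖x - y‖ ^ 2 ≤ coshGap y x := by
  have h1 := one_sub_norm_sq_pos hx
  have h2 := one_sub_norm_sq_pos hy
  unfold coshGap
  rw [le_div_iff₀ (by positivity)]
  refine mul_le_of_le_one_right (by positivity) ?_
  exact mul_le_one₀ (by nlinarith [norm_nonneg x]) h2.le (by nlinarith [norm_nonneg y])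

lemma coshGap_pos {x y : E n} (hx : x ∈ space n) (hy : y ∈ space n) (hxy : x ≠ y) :
    0 < coshGap y x := by
  have := two_mul_norm_sub_sq_le_coshGap hx hy
  have h3 : 0 < ‖x - y‖ := norm_pos_iff.2 (sub_ne_zero.2 hxy)
  nlinarith [pow_pos h3 2]

lemma coshGap_self (y : E n) : coshGap y y = 0 := by simp [coshGap]

lemma contDiff_confField (κ : ℝ) (y : E n) : ContDiff ℝ ∞ (confField κ y) := by
  unfold confField
  have h1 : ContDiff ℝ ∞ fun x : E n => inner ℝ x y := contDiff_id.inner ℝ contDiff_const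
  have h2 : ContDiff ℝ ∞ fun x : E n => ‖x‖ ^ 2 := contDiff_norm_sq ℝ
  fun_prop

lemma contDiffOn_coshGap {y : E n} (hy : y ∈ space n) :
    ContDiffOn ℝ ∞ (coshGap y) (space n) := by
  unfold coshGap
  refine ContDiffOn.div ?_ ?_ fun x hx =>
    (mul_pos (one_sub_norm_sq_pos hx) (one_sub_norm_sq_pos hy)).ne'
  · exact (contDiff_const.mul ((contDiff_norm_sq ℝ).comp (contDiff_id.sub contDiff_const))).contDiffOn
  · exact ((contDiff_const.sub (contDiff_norm_sq ℝ)).mul contDiff_const).contDiffOn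

lemma hasFDerivAt_norm_sq_sub (y x : E n) :
    HasFDerivAt (fun x : E n => ‖x - y‖ ^ 2) (2 • innerSL ℝ (x - y)) x := by
  exact (hasStrictFDerivAt_norm_sq (x - y)).hasFDerivAt.comp x ((hasFDerivAt_id x).sub_const y)

lemma hasFDerivAt_coshGap {κ : ℝ} (hκ : 0 < κ) {x y : E n} (hx : x ∈ space n)
    (hy : y ∈ space n) :
    HasFDerivAt (coshGap y) (innerSL ℝ (conf κ x ^ 2 • confField κ y x)) x := by
  have h1 := one_sub_norm_sq_pos hx
  have h2 := one_sub_norm_sq_pos hy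
  have hN : HasFDerivAt (fun x : E n => 2 * ‖x - y‖ ^ 2) _ x :=
    (hasFDerivAt_norm_sq_sub y x).const_mul 2
  have hM : HasFDerivAt (fun x : E n => (1 - ‖x‖ ^ 2) * (1 - ‖y‖ ^ 2)) _ x :=
    ((hasStrictFDerivAt_norm_sq x).hasFDerivAt.const_sub 1).mul_const (1 - ‖y‖ ^ 2)
  have hI : HasFDerivAt (fun x : E n => ((1 - ‖x‖ ^ 2) * (1 - ‖y‖ ^ 2))⁻¹) _ x :=
    (hasDerivAt_inv (mul_pos h1 h2).ne').comp_hasFDerivAt x hM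
  refine (hN.mul hI).congr_fderiv ?_
  ext v
  simp only [confField, conf, smul_eq_mul, smul_apply,
    add_apply, neg_apply, innerSL_apply_apply, inner_sub_left,
    inner_smul_left, conj_trivial, nsmul_eq_mul, norm_sub_sq_expand, Nat.cast_ofNat]
  field_simp
  ring

/-- This is |∇_κ cosh ψ|² = κ² sinh² ψ, with sinh² ψ = s (s + 2). -/
lemma conf_sq_mul_norm_confField_sq {κ : ℝ} (hκ : 0 < κ) {x y : E n} (hx : x ∈ space n)
    (hy : y ∈ space n) :
    conf κ x ^ 2 * ‖confField κ y x‖ ^ 2 = κ ^ 2 * (coshGap y x * (coshGap y x + 2)) := by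
  have h1 := one_sub_norm_sq_pos hx
  have h2 := one_sub_norm_sq_pos hy
  rw [← real_inner_self_eq_norm_sq (confField κ y x)]
  simp only [confField, conf, coshGap, inner_sub_left, inner_sub_right,
    inner_smul_left, inner_smul_right, conj_trivial, norm_sub_sq_expand,
    real_inner_self_eq_norm_sq, real_inner_comm x y]
  field_simp
  ring

/-! ### Lower bound for the length of curves -/

lemma tangentNorm_eq {κ : ℝ} (hκ : 0 < κ) {x : E n} (hx : x ∈ space n) (v : E n) :
    tangentNorm κ x v = conf κ x * ‖v‖ := by
  rw [tangentNorm, metric, real_inner_self_eq_norm_sq, ← mul_pow, Real.sqrt_sq]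
  exact mul_nonneg (conf_pos hκ hx).le (norm_nonneg v)

/-- The function arcosh(1 + s + ε)/κ has Riemannian gradient of norm at most 1, so it grows along a
curve by no more than the length. The shift ε keeps the argument of arcosh above 1, where it is
differentiable, even when the curve passes through y. -/
lemma arcosh_coshGap_sub_le_curveLength {κ : ℝ} (hκ : 0 < κ) {x y : E n}
    (hy : y ∈ space n) {γ : ℝ → E n} (hγ : IsCurve γ y x) {ε : ℝ} (hε : 0 < ε) :
    Real.arcosh (1 + coshGap y x + ε) / κ - Real.arcosh (1 + ε) / κ ≤ curveLength κ γ := by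
  have hu : UniqueDiffOn ℝ (Icc (0 : ℝ) 1) := uniqueDiffOn_Icc zero_lt_one
  have hdc : ContinuousOn (derivWithin γ (Icc 0 1)) (Icc 0 1) :=
    hγ.contDiffOn.continuousOn_derivWithin hu le_rfl
  have hγc : ContinuousOn γ (Icc 0 1) := hγ.contDiffOn.continuousOn
  have hgap : ∀ z ∈ space n, 1 < 1 + coshGap y z + ε := fun z hz => by
    linarith [coshGap_nonneg hz hy]
  have key := intervalIntegral.sub_le_integral_of_hasDeriv_right_of_le
    (g := fun t => Real.arcosh (1 + coshGap y (γ t) + ε) / κ)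
    (g' := fun t => (√((1 + coshGap y (γ t) + ε) ^ 2 - 1))⁻¹ *
      inner ℝ (conf κ (γ t) ^ 2 • confField κ y (γ t)) (derivWithin γ (Icc 0 1) t) / κ)
    (φ := fun t => tangentNorm κ (γ t) (derivWithin γ (Icc 0 1) t)) (a := 0) (b := 1) zero_le_one
    ?_ ?_ ?_ ?_
  · simpa only [hγ.source, hγ.target, coshGap_self, add_zero, curveLength] using key
  · refine ContinuousOn.div_const ?_ κ
    refine Real.continuousOn_arcosh.comp ?_ fun t ht => (hgap _ (hγ.mapsTo ht)).le
    exact (continuousOn_const.add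
      ((contDiffOn_coshGap hy).continuousOn.comp hγc hγ.mapsTo)).add continuousOn_const
  · intro t ht
    have ht' : t ∈ Icc (0 : ℝ) 1 := Ioo_subset_Icc_self ht
    have hz := hγ.mapsTo ht'
    have hd : HasDerivAt γ (derivWithin γ (Icc 0 1) t) t :=
      ((hγ.contDiffOn.differentiableOn one_ne_zero t ht').hasDerivWithinAt).hasDerivAt
        (Icc_mem_nhds ht.1 ht.2)
    have h1 := (hasFDerivAt_coshGap hκ hz hy).comp_hasDerivAt t hd
    have h2 : HasDerivAt (fun t => 1 + coshGap y (γ t) + ε) _ t := (h1.const_add 1).add_const ε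
    exact (((Real.hasDerivAt_arcosh (hgap _ hz)).comp t h2).div_const κ).hasDerivWithinAt
  · refine ContinuousOn.integrableOn_Icc ?_
    refine ((((contDiffOn_conf hκ).continuousOn.comp hγc hγ.mapsTo)).mul hdc.norm).congr
      fun t ht => ?_
    exact tangentNorm_eq hκ (hγ.mapsTo ht) _
  · intro t ht
    have hz := hγ.mapsTo (Ioo_subset_Icc_self ht)
    set z := γ t
    set v := derivWithin γ (Icc 0 1) t
    have hp := conf_pos hκ hz
    have hg := coshGap_nonneg hz hy
    have hS : 0 < √((1 + coshGap y z + ε) ^ 2 - 1) := Real.sqrt_pos.2 (by nlinarith)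
    have hY : conf κ z * ‖confField κ y z‖ ≤ κ * √((1 + coshGap y z + ε) ^ 2 - 1) := by
      refine le_of_sq_le_sq ?_ (by positivity)
      rw [mul_pow, mul_pow, conf_sq_mul_norm_confField_sq hκ hz hy,
        Real.sq_sqrt (by nlinarith)]
      gcongr
      nlinarith
    rw [tangentNorm_eq hκ hz, div_le_iff₀ hκ, inv_mul_le_iff₀ hS]
    refine (real_inner_le_norm _ _).trans ?_
    rw [norm_smul, Real.norm_of_nonneg (by positivity)]
    calc conf κ z ^ 2 * ‖confField κ y z‖ * ‖v‖
        = (conf κ z * ‖confField κ y z‖) * (conf κ z * ‖v‖) := by ring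
      _ ≤ (κ * √((1 + coshGap y z + ε) ^ 2 - 1)) * (conf κ z * ‖v‖) := by gcongr
      _ = _ := by ring

lemma arcosh_coshGap_le_curveLength {κ : ℝ} (hκ : 0 < κ) {x y : E n} (hx : x ∈ space n)
    (hy : y ∈ space n) {γ : ℝ → E n} (hγ : IsCurve γ y x) :
    Real.arcosh (1 + coshGap y x) / κ ≤ curveLength κ γ := by
  have hg := coshGap_nonneg hx hy
  have hlim : Tendsto (fun ε : ℝ => Real.arcosh (1 + coshGap y x + ε) / κ -
      Real.arcosh (1 + ε) / κ) (𝓝[>] 0)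
      (𝓝 (Real.arcosh (1 + coshGap y x + 0) / κ - Real.arcosh (1 + 0) / κ)) := by
    have haux : ∀ c : ℝ, 1 ≤ c →
        Tendsto (fun ε : ℝ => Real.arcosh (c + ε)) (𝓝[>] 0) (𝓝 (Real.arcosh (c + 0))) := by
      intro c hc
      have h1 : ContinuousOn (fun ε : ℝ => Real.arcosh (c + ε)) (Ici 0) :=
        Real.continuousOn_arcosh.comp (by fun_prop) fun t (ht : 0 ≤ t) => by
          simp only [mem_Ici]; linarith
      exact (h1 0 self_mem_Ici).mono_left (nhdsWithin_mono _ Ioi_subset_Ici_self)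
    exact ((haux _ (by linarith)).div_const κ).sub ((haux 1 le_rfl).div_const κ)
  simp only [add_zero, Real.arcosh_zero, zero_div, sub_zero] at hlim
  refine le_of_tendsto hlim ?_
  filter_upwards [self_mem_nhdsWithin] with ε hε
  exact arcosh_coshGap_sub_le_curveLength hκ hy hγ hε

/-! ### Geodesics through the hyperboloid model -/

/-- The geodesic of the ball model through the point with hyperboloid coordinates `(t₀, v₀)` and
with hyperboloid velocity `(t₁, v₁)`. -/
def geodesic (t₀ t₁ : ℝ) (v₀ v₁ : E n) (s : ℝ) : E n :=
  (1 + (Real.cosh s * t₀ + Real.sinh s * t₁))⁻¹ • (Real.cosh s • v₀ + Real.sinh s • v₁)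

section geodesic

variable {t₀ t₁ : ℝ} {v₀ v₁ : E n}

/-- By Cauchy-Schwarz the constraints force t₁² ≤ t₀² - 1, so |t₁| < t₀; combine this with |sinh s|
< cosh s. -/
lemma geodesic_time_pos (ht₀ : 0 < t₀) (h₀ : ‖v₀‖ ^ 2 = t₀ ^ 2 - 1) (h₁ : ‖v₁‖ ^ 2 = 1 + t₁ ^ 2)
    (h₀₁ : inner ℝ v₀ v₁ = t₀ * t₁) (s : ℝ) : 0 < Real.cosh s * t₀ + Real.sinh s * t₁ := by
  have hcs : (t₀ * t₁) ^ 2 ≤ ‖v₀‖ ^ 2 * ‖v₁‖ ^ 2 := by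
    rw [← h₀₁, ← mul_pow, sq_le_sq, abs_of_nonneg (a := ‖v₀‖ * ‖v₁‖) (by positivity)]
    exact abs_real_inner_le_norm _ _
  have h1 : |t₁| < t₀ := abs_lt_of_sq_lt_sq (by rw [h₀, h₁] at hcs; nlinarith) ht₀.le
  have h2 : |Real.sinh s| < Real.cosh s :=
    abs_lt_of_sq_lt_sq (by linarith [Real.cosh_sq s]) (Real.cosh_pos s).le
  have h3 : |Real.sinh s * t₁| < Real.cosh s * t₀ := by
    rw [abs_mul]
    exact mul_lt_mul'' h2 h1 (abs_nonneg _) (abs_nonneg _)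
  linarith [(abs_lt.1 h3).1]

lemma norm_geodesic_sq (ht₀ : 0 < t₀) (h₀ : ‖v₀‖ ^ 2 = t₀ ^ 2 - 1) (h₁ : ‖v₁‖ ^ 2 = 1 + t₁ ^ 2)
    (h₀₁ : inner ℝ v₀ v₁ = t₀ * t₁) (s : ℝ) :
    1 - ‖geodesic t₀ t₁ v₀ v₁ s‖ ^ 2 = 2 / (1 + (Real.cosh s * t₀ + Real.sinh s * t₁)) := by
  have hτ := geodesic_time_pos ht₀ h₀ h₁ h₀₁ s
  rw [← real_inner_self_eq_norm_sq]
  simp only [geodesic, inner_add_left, inner_add_right, inner_smul_left, inner_smul_right,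
    conj_trivial, real_inner_self_eq_norm_sq, real_inner_comm v₀ v₁, h₀, h₁, h₀₁]
  have hc := Real.cosh_sq s
  field_simp
  linear_combination hc

lemma geodesic_mem_space (ht₀ : 0 < t₀) (h₀ : ‖v₀‖ ^ 2 = t₀ ^ 2 - 1)
    (h₁ : ‖v₁‖ ^ 2 = 1 + t₁ ^ 2) (h₀₁ : inner ℝ v₀ v₁ = t₀ * t₁) (s : ℝ) :
    geodesic t₀ t₁ v₀ v₁ s ∈ space n := by
  have hτ := geodesic_time_pos ht₀ h₀ h₁ h₀₁ s
  rw [mem_space_iff, norm_geodesic_sq ht₀ h₀ h₁ h₀₁]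
  positivity

lemma contDiff_geodesic (ht₀ : 0 < t₀) (h₀ : ‖v₀‖ ^ 2 = t₀ ^ 2 - 1)
    (h₁ : ‖v₁‖ ^ 2 = 1 + t₁ ^ 2) (h₀₁ : inner ℝ v₀ v₁ = t₀ * t₁) :
    ContDiff ℝ 1 (geodesic t₀ t₁ v₀ v₁) := by
  unfold geodesic
  have hc := Real.contDiff_cosh (n := 1)
  have hs := Real.contDiff_sinh (n := 1)
  have h3 : ContDiff ℝ 1 fun s => 1 + (Real.cosh s * t₀ + Real.sinh s * t₁) := by fun_prop
  have h4 : ContDiff ℝ 1 fun s => Real.cosh s • v₀ + Real.sinh s • v₁ := by fun_prop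
  refine (h3.inv fun s => ?_).smul h4
  have := geodesic_time_pos ht₀ h₀ h₁ h₀₁ s
  positivity

/-- Multiplied by the conformal factor along the curve, this Euclidean speed becomes the constant
1/κ. -/
lemma norm_deriv_geodesic (ht₀ : 0 < t₀) (h₀ : ‖v₀‖ ^ 2 = t₀ ^ 2 - 1)
    (h₁ : ‖v₁‖ ^ 2 = 1 + t₁ ^ 2) (h₀₁ : inner ℝ v₀ v₁ = t₀ * t₁) (s : ℝ) :
    ‖deriv (geodesic t₀ t₁ v₀ v₁) s‖ = (1 + (Real.cosh s * t₀ + Real.sinh s * t₁))⁻¹ := by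
  have hτ := geodesic_time_pos ht₀ h₀ h₁ h₀₁ s
  have hd1 : HasDerivAt (fun s => 1 + (Real.cosh s * t₀ + Real.sinh s * t₁))
      (Real.sinh s * t₀ + Real.cosh s * t₁) s :=
    (((Real.hasDerivAt_cosh s).mul_const t₀).add ((Real.hasDerivAt_sinh s).mul_const t₁)).const_add 1
  have hd2 : HasDerivAt (fun s => Real.cosh s • v₀ + Real.sinh s • v₁)
      (Real.sinh s • v₀ + Real.cosh s • v₁) s :=
    ((Real.hasDerivAt_cosh s).smul_const v₀).add ((Real.hasDerivAt_sinh s).smul_const v₁)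
  have hd : HasDerivAt (geodesic t₀ t₁ v₀ v₁) _ s :=
    (hd1.fun_inv (by positivity)).smul hd2
  rw [hd.deriv]
  refine (sq_eq_sq₀ (norm_nonneg _) (by positivity)).1 ?_
  rw [← real_inner_self_eq_norm_sq]
  simp only [inner_add_left, inner_add_right, inner_smul_left, inner_smul_right,
    conj_trivial, real_inner_self_eq_norm_sq, real_inner_comm v₀ v₁, h₀, h₁, h₀₁]
  have hc := Real.cosh_sq s
  set c := Real.cosh s
  set σ := Real.sinh s
  field_simp
  linear_combination ((1 + (c * t₀ + σ * t₁)) ^ 2 - (σ * t₀ + c * t₁) ^ 2) * hc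

end geodesic

lemma exists_curve_length_eq {κ : ℝ} (hκ : 0 < κ) {x y : E n} (hx : x ∈ space n)
    (hy : y ∈ space n) (hxy : x ≠ y) :
    ∃ γ : ℝ → E n, IsCurve γ y x ∧ Real.arcosh (1 + coshGap y x) / κ = curveLength κ γ := by
  have hg := coshGap_pos hx hy hxy
  have h1 := one_sub_norm_sq_pos hx
  have h2 := one_sub_norm_sq_pos hy
  obtain ⟨D, hD⟩ : ∃ D, D = Real.arcosh (1 + coshGap y x) := ⟨_, rfl⟩
  have hDpos : 0 < D := hD ▸ Real.arcosh_pos (by linarith)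
  have hcosh : Real.cosh D = 1 + coshGap y x := hD ▸ Real.cosh_arcosh (by linarith)
  have hsinh : 0 < Real.sinh D := Real.sinh_pos_iff.2 hDpos
  have hc := Real.cosh_sq D
  -- Hyperboloid coordinates of the two endpoints; their Lorentz product is cosh D.
  obtain ⟨t₀, ht₀⟩ : ∃ t, t = (1 + ‖y‖ ^ 2) / (1 - ‖y‖ ^ 2) := ⟨_, rfl⟩
  obtain ⟨tx, htx⟩ : ∃ t, t = (1 + ‖x‖ ^ 2) / (1 - ‖x‖ ^ 2) := ⟨_, rfl⟩
  obtain ⟨v₀, hv₀⟩ : ∃ v, v = (2 / (1 - ‖y‖ ^ 2)) • y := ⟨_, rfl⟩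
  obtain ⟨vx, hvx⟩ : ∃ v, v = (2 / (1 - ‖x‖ ^ 2)) • x := ⟨_, rfl⟩
  have hpos : 0 < t₀ := by rw [ht₀]; positivity
  have hn₀ : ‖v₀‖ ^ 2 = t₀ ^ 2 - 1 := by
    rw [hv₀, ht₀, norm_smul, mul_pow, Real.norm_eq_abs, sq_abs]; field_simp; ring
  have hnx : ‖vx‖ ^ 2 = tx ^ 2 - 1 := by
    rw [hvx, htx, norm_smul, mul_pow, Real.norm_eq_abs, sq_abs]; field_simp; ring
  have hin : inner ℝ v₀ vx = t₀ * tx - Real.cosh D := by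
    rw [hcosh, hv₀, hvx, ht₀, htx, coshGap, norm_sub_sq_expand, inner_smul_left, inner_smul_right,
      conj_trivial, real_inner_comm]
    field_simp; ring
  -- The initial velocity V is solved from the endpoint condition cosh D · P + sinh D · V = Q, for P
  -- and Q the lifts of y and x.
  obtain ⟨t₁, ht₁⟩ : ∃ t, t = (tx - Real.cosh D * t₀) / Real.sinh D := ⟨_, rfl⟩
  obtain ⟨v₁, hv₁⟩ : ∃ v, v = (Real.sinh D)⁻¹ • (vx - Real.cosh D • v₀) := ⟨_, rfl⟩
  have hn₁ : ‖v₁‖ ^ 2 = 1 + t₁ ^ 2 := by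
    rw [← real_inner_self_eq_norm_sq, hv₁, ht₁]
    simp only [inner_sub_left, inner_sub_right, inner_smul_left, inner_smul_right, conj_trivial,
      real_inner_self_eq_norm_sq, real_inner_comm v₀ vx, hn₀, hnx, hin]
    field_simp
    linear_combination hc
  have hn₀₁ : inner ℝ v₀ v₁ = t₀ * t₁ := by
    rw [hv₁, ht₁]
    simp only [inner_sub_right, inner_smul_right, real_inner_self_eq_norm_sq, hn₀, hin]
    field_simp
    ring
  have hsm := contDiff_geodesic hpos hn₀ hn₁ hn₀₁
  have hγ : ContDiff ℝ 1 fun t => geodesic t₀ t₁ v₀ v₁ (t * D) :=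
    hsm.comp (contDiff_id.mul contDiff_const)
  refine ⟨fun t => geodesic t₀ t₁ v₀ v₁ (t * D), ⟨hγ.contDiffOn,
    fun t _ => geodesic_mem_space hpos hn₀ hn₁ hn₀₁ _, ?_, ?_⟩, ?_⟩
  · simp only [geodesic, zero_mul, Real.cosh_zero, Real.sinh_zero, zero_smul, add_zero,
      one_mul, hv₀, smul_smul]
    rw [ht₀, show (1 + (1 + ‖y‖ ^ 2) / (1 - ‖y‖ ^ 2))⁻¹ * (2 / (1 - ‖y‖ ^ 2)) = 1 by
      field_simp; ring, one_smul]
  · have e1 : Real.cosh D * t₀ + Real.sinh D * t₁ = tx := by rw [ht₁]; field_simp; ring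
    have e2 : Real.cosh D • v₀ + Real.sinh D • v₁ = vx := by
      rw [hv₁, smul_inv_smul₀ hsinh.ne']; abel
    simp only [geodesic, one_mul, e1, e2, hvx, smul_smul]
    rw [htx, show (1 + (1 + ‖x‖ ^ 2) / (1 - ‖x‖ ^ 2))⁻¹ * (2 / (1 - ‖x‖ ^ 2)) = 1 by
      field_simp; ring, one_smul]
  · have hlen : ∀ t ∈ uIcc (0 : ℝ) 1, tangentNorm κ (geodesic t₀ t₁ v₀ v₁ (t * D))
        (derivWithin (fun t => geodesic t₀ t₁ v₀ v₁ (t * D)) (Icc 0 1) t) = D / κ := by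
      intro t ht
      rw [uIcc_of_le zero_le_one] at ht
      have hτ := geodesic_time_pos hpos hn₀ hn₁ hn₀₁ (t * D)
      have hd : HasDerivAt (fun t => geodesic t₀ t₁ v₀ v₁ (t * D))
          (D • deriv (geodesic t₀ t₁ v₀ v₁) (t * D)) t := by
        have := (hsm.differentiable one_ne_zero (t * D)).hasDerivAt.scomp t
          ((hasDerivAt_id t).mul_const D)
        rwa [one_mul] at this
      rw [hd.hasDerivWithinAt.derivWithin (uniqueDiffOn_Icc zero_lt_one t ht),
        tangentNorm_eq hκ (geodesic_mem_space hpos hn₀ hn₁ hn₀₁ _), norm_smul,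
        norm_deriv_geodesic hpos hn₀ hn₁ hn₀₁, Real.norm_of_nonneg hDpos.le, conf,
        norm_geodesic_sq hpos hn₀ hn₁ hn₀₁]
      field_simp
    rw [curveLength, intervalIntegral.integral_congr hlen, hD]
    simp

/-! ### The distance and the radial derivative in closed form -/

lemma rdist_eq {κ : ℝ} (hκ : 0 < κ) {x y : E n} (hx : x ∈ space n) (hy : y ∈ space n)
    (hxy : x ≠ y) : rdist κ y x = Real.arcosh (1 + coshGap y x) / κ := by
  refine IsLeast.csInf_eq ⟨exists_curve_length_eq hκ hx hy hxy, ?_⟩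
  rintro L ⟨γ, hγ, rfl⟩
  exact arcosh_coshGap_le_curveLength hκ hx hy hγ

lemma gradient_rdist {κ : ℝ} (hκ : 0 < κ) {x y : E n} (hx : x ∈ space n) (hy : y ∈ space n)
    (hxy : x ≠ y) :
    ∇ (rdist κ y) x = ((√((1 + coshGap y x) ^ 2 - 1))⁻¹ / κ) •
      (conf κ x ^ 2 • confField κ y x) := by
  have hg := coshGap_pos hx hy hxy
  have hev : rdist κ y =ᶠ[𝓝 x] fun z => Real.arcosh (1 + coshGap y z) / κ := by
    filter_upwards [isOpen_space.mem_nhds hx, isOpen_ne.mem_nhds hxy] with z hz hzy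
    exact rdist_eq hκ hz hy hzy
  rw [hev.gradient_eq]
  refine HasGradientAt.gradient (hasGradientAt_iff_hasFDerivAt.2 ?_)
  have h1 : HasFDerivAt (fun z => 1 + coshGap y z) _ x := (hasFDerivAt_coshGap hκ hx hy).const_add 1
  have h2 := ((Real.hasDerivAt_arcosh (x := 1 + coshGap y x)
    (by simp only [mem_Ioi]; linarith)).div_const κ).comp_hasFDerivAt x h1
  refine h2.congr_fderiv ?_
  ext v
  simp

lemma radialDeriv_eq {κ : ℝ} (hκ : 0 < κ) {x y : E n} (hx : x ∈ space n) (hy : y ∈ space n)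
    (hxy : x ≠ y) (u : E n → ℝ) :
    radialDeriv κ y u x =
      inner ℝ (∇ u x) (confField κ y x) / (κ * √((1 + coshGap y x) ^ 2 - 1)) := by
  have hp := conf_pos hκ hx
  rw [radialDeriv, metric, rgrad, rgrad, gradient_rdist hκ hx hy hxy]
  simp only [inner_smul_left, inner_smul_right, conj_trivial]
  field_simp

/-! ### Euclidean divergence calculus -/

lemma euclDiv_eq {F : E n → E n} {L : E n →L[ℝ] E n} {x : E n} (h : HasFDerivAt F L x) :
    euclDiv F x = ∑ i, L (EuclideanSpace.single i 1) i := by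
  rw [euclDiv, h.fderiv]

lemma sum_smul_single (v : E n) : ∑ i, v i • EuclideanSpace.single i (1 : ℝ) = v := by
  ext j
  simp [Finset.sum_apply, Pi.single_apply]

lemma euclDiv_smul {f : E n → ℝ} {V : E n → E n} {x : E n} {f' : E n →L[ℝ] ℝ}
    (hf : HasFDerivAt f f' x) (hV : DifferentiableAt ℝ V x) :
    euclDiv (fun y => f y • V y) x = f x * euclDiv V x + f' (V x) := by
  rw [euclDiv_eq (hf.fun_smul hV.hasFDerivAt), euclDiv, Finset.mul_sum]
  conv_rhs => rw [← sum_smul_single (V x), map_sum]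
  rw [← Finset.sum_add_distrib]
  refine Finset.sum_congr rfl fun i _ => ?_
  simp [mul_comm]

lemma euclDiv_const_smul (c : ℝ) {V : E n → E n} {x : E n} (hV : DifferentiableAt ℝ V x) :
    euclDiv (fun y => c • V y) x = c * euclDiv V x := by
  simpa using euclDiv_smul (hasFDerivAt_const c x) hV

lemma euclDiv_sub {V W : E n → E n} {x : E n}
    (hV : DifferentiableAt ℝ V x) (hW : DifferentiableAt ℝ W x) :
    euclDiv (fun y => V y - W y) x = euclDiv V x - euclDiv W x := by
  rw [euclDiv_eq (hV.hasFDerivAt.fun_sub hW.hasFDerivAt), euclDiv, euclDiv,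
    ← Finset.sum_sub_distrib]
  exact Finset.sum_congr rfl fun i _ => by simp

lemma euclDiv_id (x : E n) : euclDiv (fun y => y) x = n := by
  have h : HasFDerivAt (fun y : E n => y) (ContinuousLinearMap.id ℝ (E n)) x := hasFDerivAt_id x
  rw [euclDiv_eq h]
  simp

lemma euclDiv_const (v x : E n) : euclDiv (fun _ => v) x = 0 := by
  rw [euclDiv_eq (hasFDerivAt_const v x)]
  simp

lemma euclDiv_eq_zero_of_eventuallyEq {F : E n → E n} {x : E n} (h : F =ᶠ[𝓝 x] fun _ => 0) :
    euclDiv F x = 0 := by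
  rw [euclDiv, h.fderiv_eq]
  simp

lemma continuous_euclDiv {F : E n → E n} (hF : ContDiff ℝ 1 F) : Continuous (euclDiv F) := by
  unfold euclDiv
  have h := hF.continuous_fderiv one_ne_zero
  fun_prop

/-- The divergence theorem for compactly supported vector fields. -/
lemma integral_euclDiv {F : E n → E n} (hF : ContDiff ℝ 1 F) (hc : HasCompactSupport F) :
    ∫ x, euclDiv F x = 0 := by
  have hco (i : Fin n) : Continuous fun x => fderiv ℝ F x (EuclideanSpace.single i 1) i := by
    have h := hF.continuous_fderiv one_ne_zero
    fun_prop
  have hcs (i : Fin n) :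
      HasCompactSupport fun x => fderiv ℝ F x (EuclideanSpace.single i 1) i := by
    refine (hc.fderiv (𝕜 := ℝ)).comp_left
      (g := fun L : E n →L[ℝ] E n => L (EuclideanSpace.single i 1) i) ?_
    simp
  unfold euclDiv
  rw [integral_finsetSum _ fun i _ => (hco i).integrable_of_hasCompactSupport (hcs i)]
  refine Finset.sum_eq_zero fun i _ => ?_
  have hFi : ContDiff ℝ 1 fun x => F x i := contDiff_euclidean.1 hF i
  have hder (x v : E n) : fderiv ℝ (fun x => F x i) x v = fderiv ℝ F x v i := by
    have := ((EuclideanSpace.proj (𝕜 := ℝ) i).hasFDerivAt (x := F x)).comp x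
      (hF.differentiable one_ne_zero x).hasFDerivAt
    have h2 : fderiv ℝ (fun x => F x i) x = _ := this.fderiv
    rw [h2]; rfl
  have hFc : HasCompactSupport fun x => F x i := hc.comp_left (g := fun v : E n => v i) rfl
  -- Integration by parts against the constant function 1 makes each partial derivative integrate to
  -- zero.
  have := integral_mul_fderiv_eq_neg_fderiv_mul_of_integrable (μ := (volume : Measure (E n)))
    (f := fun _ => (1 : ℝ)) (g := fun x => F x i) (v := EuclideanSpace.single i 1) (by simp)
    (by simpa only [one_mul, hder] using (hco i).integrable_of_hasCompactSupport (hcs i))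
    (by simpa only [one_mul] using hFi.continuous.integrable_of_hasCompactSupport hFc)
    (fun x _ => differentiableAt_const _) (fun x _ => hFi.differentiable one_ne_zero x)
  simpa [hder] using this

/-! ### The Rellich-Pohozaev identity -/

lemma contDiff_gradient {u : E n → ℝ} (hu : ContDiff ℝ ∞ u) : ContDiff ℝ ∞ (∇ u) :=
  (InnerProductSpace.toDual ℝ (E n)).symm.contDiff.comp (hu.fderiv_right (m := ∞) le_rfl)

lemma inner_fderiv_gradient_comm {u : E n → ℝ} (hu : ContDiff ℝ ∞ u) (x v w : E n) :
    inner ℝ (fderiv ℝ (∇ u) x v) w = inner ℝ v (fderiv ℝ (∇ u) x w) := by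
  have hg := (contDiff_gradient hu).differentiable (by simp) x
  have hd (v w : E n) :
      fderiv ℝ (fderiv ℝ u) x v w = inner ℝ (fderiv ℝ (∇ u) x v) w := by
    have h1 : fderiv ℝ u = fun z => innerSL ℝ (∇ u z) := by
      ext z w
      simp [inner_gradient_left]
    have h2 : HasFDerivAt (fun z => innerSL ℝ (∇ u z)) _ x :=
      (innerSL ℝ (E := E n)).hasFDerivAt.comp x hg.hasFDerivAt
    rw [h1, h2.fderiv]
    rfl
  rw [← hd, real_inner_comm, ← hd]
  have : IsSymmSndFDerivAt ℝ u x := hu.contDiffAt.isSymmSndFDerivAt (by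
    simpa using WithTop.coe_le_coe.2 (le_top : (2 : ℕ∞) ≤ ⊤))
  exact this v w

/-- The pointwise Rellich-Pohozaev identity. -/
lemma euclDiv_pohozaev {u : E n → ℝ} (hu : ContDiff ℝ ∞ u) {X : E n → E n} {q : E n → ℝ}
    {x : E n} (hX : DifferentiableAt ℝ X x) (hq : DifferentiableAt ℝ q x) :
    euclDiv (fun z => inner ℝ (X z) (∇ u z) • q z • ∇ u z -
        (‖∇ u z‖ ^ 2 / 2) • q z • X z) x =
      inner ℝ (X x) (∇ u x) * euclDiv (fun z => q z • ∇ u z) x +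
        q x * inner ℝ (fderiv ℝ X x (∇ u x)) (∇ u x) -
        ‖∇ u x‖ ^ 2 / 2 * euclDiv (fun z => q z • X z) x := by
  have hg := (contDiff_gradient hu).differentiable (by simp) x
  have h1 := hX.hasFDerivAt.inner ℝ hg.hasFDerivAt
  have h2 : HasFDerivAt (fun z => ‖∇ u z‖ ^ 2 / 2)
      ((innerSL ℝ (∇ u x)).comp (fderiv ℝ (∇ u) x)) x := by
    have h3 : HasFDerivAt (fun z => ‖∇ u z‖ ^ 2 * 2⁻¹) _ x :=
      hg.hasFDerivAt.norm_sq.mul_const (2⁻¹ : ℝ)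
    simp only [div_eq_mul_inv]
    refine h3.congr_fderiv ?_
    ext v
    simp
  have h3 := hq.fun_smul hg
  have h4 := hq.fun_smul hX
  rw [euclDiv_sub (h1.differentiableAt.fun_smul h3) (h2.differentiableAt.fun_smul h4),
    euclDiv_smul h1 h3, euclDiv_smul h2 h4]
  -- Symmetry of the Hessian cancels the two terms containing D²u(X, ∇u), one from each half of the
  -- field.
  have hs := inner_fderiv_gradient_comm hu x (∇ u x) (X x)
  rw [real_inner_comm, inner_gradient_left] at hs
  simp [fderivInnerCLM_apply, hs]
  ring

lemma hasFDerivAt_conf_pow {κ : ℝ} (hκ : 0 < κ) {x : E n} (hx : x ∈ space n) (k : ℕ) :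
    HasFDerivAt (fun z => conf κ z ^ k)
      ((k * conf κ x ^ k * (2 / (1 - ‖x‖ ^ 2))) • innerSL ℝ x) x := by
  have h1 := one_sub_norm_sq_pos hx
  have hp := conf_pos hκ hx
  have hM : HasFDerivAt (fun z : E n => κ * (1 - ‖z‖ ^ 2)) _ x :=
    ((hasStrictFDerivAt_norm_sq x).hasFDerivAt.const_sub 1).const_mul κ
  have hI : HasFDerivAt (fun z : E n => (2 * (κ * (1 - ‖z‖ ^ 2))⁻¹)) _ x :=
    ((hasDerivAt_inv (mul_pos hκ h1).ne').comp_hasFDerivAt x hM).const_mul 2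
  have hk : HasFDerivAt (fun z : E n => (2 * (κ * (1 - ‖z‖ ^ 2))⁻¹) ^ k) _ x := hI.pow k
  have he : (fun z : E n => conf κ z ^ k) = fun z => (2 * (κ * (1 - ‖z‖ ^ 2))⁻¹) ^ k := by
    ext z; rw [conf, div_eq_mul_inv]
  rw [he]
  refine hk.congr_fderiv ?_
  ext v
  rcases k with _ | k
  · simp
  · simp only [conf, smul_apply, neg_apply, innerSL_apply_apply, smul_eq_mul, nsmul_eq_mul,
      Nat.cast_ofNat, Nat.add_sub_cancel]
    generalize 1 - ‖x‖ ^ 2 = w at h1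
    rw [pow_succ _ k, div_eq_mul_inv 2 (κ * w)]
    generalize (2 * (κ * w)⁻¹) ^ k = P
    field_simp

section confField

variable (κ : ℝ) (y x : E n)

lemma hasFDerivAt_inner_const : HasFDerivAt (fun x : E n => inner ℝ x y) (innerSL ℝ y) x := by
  simp only [real_inner_comm]
  exact (innerSL ℝ y).hasFDerivAt

lemma hasFDerivAt_confField :
    HasFDerivAt (confField κ y) ((κ ^ 2 / (1 - ‖y‖ ^ 2)) •
      ((1 + ‖y‖ ^ 2 - 2 * inner ℝ x y) • ContinuousLinearMap.id ℝ (E n) +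
        ((2 : ℝ) • (innerSL ℝ x).smulRight y - (2 : ℝ) • (innerSL ℝ y).smulRight x))) x := by
  have h1 : HasFDerivAt (fun x : E n => (1 + ‖y‖ ^ 2) • x) _ x :=
    (hasFDerivAt_id (𝕜 := ℝ) x).const_smul (1 + ‖y‖ ^ 2)
  have h2 : HasFDerivAt (fun x : E n => (1 - ‖x‖ ^ 2) • y) _ x :=
    ((hasStrictFDerivAt_norm_sq x).hasFDerivAt.const_sub 1).smul_const y
  have h3 : HasFDerivAt (fun x : E n => (2 * inner ℝ x y) • x) _ x :=
    ((hasFDerivAt_inner_const y x).const_mul (2 : ℝ)).smul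
      (hasFDerivAt_id (𝕜 := ℝ) x)
  have := ((h1.sub h2).sub h3).const_smul (κ ^ 2 / (1 - ‖y‖ ^ 2))
  refine HasFDerivAt.congr_fderiv this ?_
  ext v i
  simp [real_inner_comm]
  ring

/-- The derivative is a multiple of the identity plus a skew part built from x and y, and the skew
part drops out of the quadratic form. -/
lemma inner_fderiv_confField_self (v : E n) :
    inner ℝ (fderiv ℝ (confField κ y) x v) v =
      κ ^ 2 / (1 - ‖y‖ ^ 2) * (1 + ‖y‖ ^ 2 - 2 * inner ℝ x y) * ‖v‖ ^ 2 := by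
  rw [(hasFDerivAt_confField κ y x).fderiv]
  simp [inner_add_left, inner_sub_left, inner_smul_left]
  ring

lemma euclDiv_confField :
    euclDiv (confField κ y) x =
      n * (κ ^ 2 / (1 - ‖y‖ ^ 2) * (1 + ‖y‖ ^ 2 - 2 * inner ℝ x y)) := by
  have h2 : HasFDerivAt (fun x : E n => 1 - ‖x‖ ^ 2) _ x :=
    ((hasStrictFDerivAt_norm_sq x).hasFDerivAt.const_sub 1)
  have h3 : HasFDerivAt (fun x : E n => 2 * inner ℝ x y) _ x :=
    (hasFDerivAt_inner_const y x).const_mul 2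
  have hid : DifferentiableAt ℝ (fun x : E n => x) x := differentiableAt_id
  have d1 : DifferentiableAt ℝ (fun x : E n => (1 + ‖y‖ ^ 2) • x) x :=
    hid.const_smul (1 + ‖y‖ ^ 2)
  have d2 : DifferentiableAt ℝ (fun x : E n => (1 - ‖x‖ ^ 2) • y) x :=
    h2.differentiableAt.smul (differentiableAt_const y)
  have d3 : DifferentiableAt ℝ (fun x : E n => (2 * inner ℝ x y) • x) x :=
    h3.differentiableAt.smul hid
  unfold confField
  rw [euclDiv_const_smul _ ((d1.fun_sub d2).fun_sub d3), euclDiv_sub (d1.fun_sub d2) d3, euclDiv_sub d1 d2,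
    euclDiv_const_smul _ hid, euclDiv_smul h2 (differentiableAt_const y),
    euclDiv_smul h3 hid, euclDiv_id, euclDiv_const]
  simp [real_inner_comm]
  ring

end confField

/-- The Rellich-Pohozaev field of `f(cosh (κ d(y, ·)) - 1) • confField κ y`. -/
def rellichField (κ : ℝ) (y : E n) (u : E n → ℝ) (f : ℝ → ℝ) (z : E n) : E n :=
  inner ℝ (f (coshGap y z) • confField κ y z) (∇ u z) • conf κ z ^ (n - 2) • ∇ u z -
    (‖∇ u z‖ ^ 2 / 2) • conf κ z ^ (n - 2) • f (coshGap y z) • confField κ y z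

lemma conf_zpow_eq (hn : 2 ≤ n) (κ : ℝ) (x : E n) :
    conf κ x ^ ((n : ℤ) - 2) = conf κ x ^ (n - 2) := by
  rw [← zpow_natCast, Nat.cast_sub hn, Nat.cast_ofNat]

/-- Conformality of Y makes ⟨DY ∇u, ∇u⟩ a multiple of |∇u|², so only Δu, |∇u|² and ⟨Y, ∇u⟩ survive;
differentiating f(s) contributes the two terms in f'. -/
lemma euclDiv_rellichField {κ : ℝ} (hκ : 0 < κ) (hn : 2 ≤ n) {x y : E n} (hx : x ∈ space n)
    (hy : y ∈ space n) {u : E n → ℝ} (hu : ContDiff ℝ ∞ u) {f : ℝ → ℝ} {f' : ℝ}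
    (hf : HasDerivAt f f' (coshGap y x)) :
    euclDiv (rellichField κ y u f) x =
      conf κ x ^ n * laplaceBeltrami κ u x * (f (coshGap y x) * inner ℝ (confField κ y x) (∇ u x)) -
      conf κ x ^ (n - 2) * ‖∇ u x‖ ^ 2 * (((n : ℝ) - 2) / 2 * κ ^ 2 *
        f (coshGap y x) * (1 + coshGap y x) +
        κ ^ 2 / 2 * f' * (coshGap y x * (coshGap y x + 2))) +
      conf κ x ^ n * f' * inner ℝ (confField κ y x) (∇ u x) ^ 2 := by
  have h1 := one_sub_norm_sq_pos hx
  have h2 := one_sub_norm_sq_pos hy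
  have hp := conf_pos hκ hx
  have hY := (hasFDerivAt_confField κ y x)
  have hfs := hf.comp_hasFDerivAt x (hasFDerivAt_coshGap hκ hx hy)
  have hX : HasFDerivAt (fun z => f (coshGap y z) • confField κ y z) _ x :=
    hfs.smul (hY.differentiableAt.hasFDerivAt)
  have hq := hasFDerivAt_conf_pow hκ hx (n - 2)
  unfold rellichField
  rw [euclDiv_pohozaev hu hX.differentiableAt hq.differentiableAt, hX.fderiv,
    euclDiv_smul hq hX.differentiableAt]
  have hdiv := euclDiv_smul hfs hY.differentiableAt
  simp only [Function.comp] at hdiv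
  rw [hdiv, euclDiv_confField, laplaceBeltrami]
  simp only [conf_zpow_eq hn]
  simp only [add_apply, smul_apply, ContinuousLinearMap.smulRight_apply, inner_add_left,
    inner_smul_left, conj_trivial, inner_fderiv_confField_self, smul_eq_mul, innerSL_apply_apply,
    inner_smul_right, real_inner_self_eq_norm_sq, Function.comp]
  have hpn : conf κ x ^ n = conf κ x ^ (n - 2) * conf κ x ^ 2 := by
    rw [← pow_add, Nat.sub_add_cancel hn]
  have hYs := conf_sq_mul_norm_confField_sq hκ hx hy
  rw [mul_inv_cancel_left₀ (by positivity), hpn, hYs, Nat.cast_sub hn, Nat.cast_ofNat]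
  -- The Euclidean dilation factor of Y is the Riemannian one, κ² cosh ψ, minus the derivative of
  -- log p_κ along Y.
  have hconf : κ ^ 2 / (1 - ‖y‖ ^ 2) * (1 + ‖y‖ ^ 2 - 2 * inner ℝ x y) =
      κ ^ 2 * (1 + coshGap y x) - 2 / (1 - ‖x‖ ^ 2) * inner ℝ x (confField κ y x) := by
    simp only [coshGap, confField, inner_smul_right, inner_sub_right, norm_sub_sq_expand,
      real_inner_self_eq_norm_sq]
    field_simp
    ring
  rw [hconf]
  ring

/-! ### Supports and integrability near the pole -/

section support

variable {u : E n → ℝ} {x : E n}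

lemma gradient_eventuallyEq_zero (hx : x ∉ tsupport u) : ∇ u =ᶠ[𝓝 x] fun _ => 0 := by
  have h : u =ᶠ[𝓝 x] fun _ => 0 := notMem_tsupport_iff_eventuallyEq.1 hx
  refine h.gradient.trans (Eventually.of_forall fun z => ?_)
  exact gradient_fun_const z 0

lemma gradient_eq_zero (hx : x ∉ tsupport u) : ∇ u x = 0 :=
  (gradient_eventuallyEq_zero hx).eq_of_nhds

lemma laplaceBeltrami_eq_zero (κ : ℝ) (hx : x ∉ tsupport u) : laplaceBeltrami κ u x = 0 := by
  rw [laplaceBeltrami, euclDiv_eq_zero_of_eventuallyEq, mul_zero]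
  filter_upwards [gradient_eventuallyEq_zero hx] with z hz
  rw [hz, smul_zero]

lemma radialDeriv_eq_zero (κ : ℝ) (y : E n) (hx : x ∉ tsupport u) : radialDeriv κ y u x = 0 := by
  simp [radialDeriv, metric, rgrad, gradient_eq_zero hx]

lemma contDiff_of_contDiffOn_space {F : Type*} [NormedAddCommGroup F] [NormedSpace ℝ F]
    {k : WithTop ℕ∞} {g : E n → F} {K : Set (E n)} (hK : IsClosed K) (hKs : K ⊆ space n)
    (hg : ContDiffOn ℝ k g (space n)) (h0 : ∀ x ∉ K, g x = 0) : ContDiff ℝ k g := by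
  refine contDiff_iff_contDiffAt.2 fun x => ?_
  by_cases hx : x ∈ K
  · exact hg.contDiffAt (isOpen_space.mem_nhds (hKs hx))
  · refine (contDiffAt_const (c := (0 : F))).congr_of_eventuallyEq ?_
    filter_upwards [hK.isOpen_compl.mem_nhds hx] with z hz using h0 z hz

lemma exists_bound_of_continuousOn_space {g : E n → ℝ} {K : Set (E n)} (hK : IsCompact K)
    (hKs : K ⊆ space n) (hg : ContinuousOn g (space n)) (h0 : ∀ x ∉ K, g x = 0) :
    ∃ M, 0 ≤ M ∧ ∀ x, g x ≤ M := by
  obtain ⟨M, hM⟩ := hK.exists_bound_of_continuousOn (hg.mono hKs)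
  refine ⟨max M 0, le_max_right _ _, fun x => ?_⟩
  by_cases hx : x ∈ K
  · exact (le_abs_self _).trans ((hM x hx).trans (le_max_left _ _))
  · rw [h0 x hx]; exact le_max_right _ _

end support

/-- The power |z|⁻² is locally integrable in dimension at least 3; the radius 2 covers every
translate of the unit ball by one of its points. -/
lemma integrableOn_inv_norm_sub_sq (hn : 3 ≤ n) {y : E n} (hy : y ∈ space n) :
    IntegrableOn (fun x => (‖x - y‖ ^ 2)⁻¹) (space n) := by
  have h1 : IntegrableOn (fun x : E n => (‖x‖ ^ 2)⁻¹) (ball 0 2) := by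
    refine integrableOn_ball_of_norm_le_rpow (C := 1) (α := 2) ?_ ?_ ?_ ?_
    · rw [finrank_euclideanSpace_fin]; omega
    · rw [finrank_euclideanSpace_fin]; exact_mod_cast hn
    · refine Eventually.of_forall fun x => ?_
      rw [one_mul, Real.rpow_neg (norm_nonneg x), Real.norm_of_nonneg (by positivity),
        Real.rpow_two]
    · exact (by fun_prop : Measurable fun x : E n => (‖x‖ ^ 2)⁻¹).aestronglyMeasurable
  have h2 := ((measurePreserving_sub_right (volume : Measure (E n)) y).integrableOn_comp_preimage
    (MeasurableEquiv.subRight y).measurableEmbedding).2 h1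
  refine h2.mono_set fun x hx => ?_
  simp only [space, mem_ball_zero_iff] at hx hy
  simp only [mem_preimage, mem_ball_zero_iff]
  linarith [norm_sub_le x y]

lemma integrableOn_space_of_le (hn : 3 ≤ n) {y : E n} (hy : y ∈ space n) {g : E n → ℝ} {M : ℝ}
    (hg : ContinuousOn g (space n \ {y}))
    (hb : ∀ x ∈ space n, x ≠ y → |g x| ≤ M * (‖x - y‖ ^ 2)⁻¹) : IntegrableOn g (space n) := by
  have : Nonempty (Fin n) := ⟨⟨0, by omega⟩⟩
  have hae : (space n \ {y} : Set (E n)) =ᵐ[volume] space n :=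
    sdiff_null_ae_eq_self (measure_singleton y)
  refine IntegrableOn.congr_set_ae ?_ hae.symm
  have hm : MeasurableSet (space n \ {y}) :=
    isOpen_space.measurableSet.diff (measurableSet_singleton y)
  refine Integrable.mono' (((integrableOn_inv_norm_sub_sq hn hy).mono_set sdiff_subset).const_mul M)
    (hg.aestronglyMeasurable hm) ?_
  refine (ae_restrict_iff' hm).2 (Eventually.of_forall fun x hx => ?_)
  exact hb x hx.1 hx.2

lemma ae_restrict_space_ne (hn : 3 ≤ n) (y : E n) :
    ∀ᵐ x ∂(volume.restrict (space n)), x ∈ space n ∧ x ≠ y := by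
  have : Nonempty (Fin n) := ⟨⟨0, by omega⟩⟩
  filter_upwards [ae_restrict_mem isOpen_space.measurableSet,
    ae_restrict_of_ae (Measure.ae_ne volume y)] with x h1 h2 using ⟨h1, h2⟩

/-! ### The radial density and the weighted Rellich inequality -/

section regular

variable {κ : ℝ} {y : E n} {u : E n → ℝ}

/-- The density `|∂ᵣ u|² p_κⁿ`, written without the distance function. -/
def radialDensity (κ : ℝ) (y : E n) (u : E n → ℝ) (x : E n) : ℝ :=
  conf κ x ^ n * inner ℝ (confField κ y x) (∇ u x) ^ 2 /
    (κ ^ 2 * (coshGap y x * (coshGap y x + 2)))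

lemma radialDensity_nonneg (hκ : 0 < κ) {x : E n} (hx : x ∈ space n) (hy : y ∈ space n) :
    0 ≤ radialDensity κ y u x := by
  have := conf_pos hκ hx
  have := coshGap_nonneg hx hy
  unfold radialDensity
  positivity

/-- Cauchy-Schwarz: the radial derivative is at most the full gradient. -/
lemma radialDensity_le (hκ : 0 < κ) (hn : 2 ≤ n) {x : E n} (hx : x ∈ space n) (hy : y ∈ space n)
    (hxy : x ≠ y) : radialDensity κ y u x ≤ conf κ x ^ (n - 2) * ‖∇ u x‖ ^ 2 := by
  have hp := conf_pos hκ hx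
  have hs := coshGap_pos hx hy hxy
  have hpn : conf κ x ^ n = conf κ x ^ (n - 2) * conf κ x ^ 2 := by
    rw [← pow_add, Nat.sub_add_cancel hn]
  have hcs : inner ℝ (confField κ y x) (∇ u x) ^ 2 ≤ ‖confField κ y x‖ ^ 2 * ‖∇ u x‖ ^ 2 := by
    rw [← mul_pow]
    exact sq_le_sq.2 ((abs_real_inner_le_norm _ _).trans (le_abs_self _))
  rw [radialDensity, div_le_iff₀ (by positivity), ← conf_sq_mul_norm_confField_sq hκ hx hy, hpn]
  calc conf κ x ^ (n - 2) * conf κ x ^ 2 * inner ℝ (confField κ y x) (∇ u x) ^ 2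
      ≤ conf κ x ^ (n - 2) * conf κ x ^ 2 * (‖confField κ y x‖ ^ 2 * ‖∇ u x‖ ^ 2) := by gcongr
    _ = _ := by ring

variable (hκ : 0 < κ) (hy : y ∈ space n) (hu : ContDiff ℝ ∞ u)

include hκ hy hu in
lemma continuousOn_radialDensity : ContinuousOn (radialDensity κ y u) (space n \ {y}) := by
  have h1 := ((contDiffOn_conf (n := n) hκ).continuousOn).mono (sdiff_subset (t := {y}))
  have h2 := ((contDiffOn_coshGap hy).continuousOn).mono (sdiff_subset (t := {y}))
  have h3 := (contDiff_confField κ y).continuous.continuousOn (s := space n \ {y})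
  have h4 := (contDiff_gradient hu).continuous.continuousOn (s := space n \ {y})
  unfold radialDensity
  refine ContinuousOn.div ((h1.pow n).mul ((h3.inner h4).pow 2))
    (continuousOn_const.mul (h2.mul (h2.add continuousOn_const))) fun x hx => ?_
  have := coshGap_pos hx.1 hy hx.2
  positivity

variable (hc : HasCompactSupport u) (hs : tsupport u ⊆ space n)

include hκ hy hu hc hs in
-- The factor (1 + s)²/(s (s + 2)) is coth² ψ, the common majorant of all weights used below. Away
-- from its pole everything is bounded by the compact support of u, and s (s + 2) ≥ |x - y|²
-- controls the pole.
lemma exists_radialDensity_bound (hn : 2 ≤ n) :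
    ∃ M, 0 ≤ M ∧ ∀ x ∈ space n, x ≠ y →
      radialDensity κ y u x * ((1 + coshGap y x) ^ 2 / (coshGap y x * (coshGap y x + 2))) ≤
        M * (‖x - y‖ ^ 2)⁻¹ := by
  obtain ⟨M, hM0, hM⟩ := exists_bound_of_continuousOn_space
    (g := fun x => conf κ x ^ (n - 2) * ‖∇ u x‖ ^ 2 * (1 + coshGap y x) ^ 2) hc.isCompact hs
    ((((contDiffOn_conf hκ).continuousOn.pow _).mul
      ((contDiff_gradient hu).continuous.continuousOn.norm.pow 2)).mul
      ((continuousOn_const.add (contDiffOn_coshGap hy).continuousOn).pow 2))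
    fun x hx => by simp [gradient_eq_zero hx]
  refine ⟨M, hM0, fun x hx hxy => ?_⟩
  have hp := conf_pos hκ hx
  have hs := coshGap_pos hx hy hxy
  have hd : 0 < ‖x - y‖ := norm_pos_iff.2 (sub_ne_zero.2 hxy)
  have h2 := two_mul_norm_sub_sq_le_coshGap hx hy
  calc _ ≤ conf κ x ^ (n - 2) * ‖∇ u x‖ ^ 2 *
        ((1 + coshGap y x) ^ 2 / (coshGap y x * (coshGap y x + 2))) := by
        gcongr
        exact radialDensity_le hκ hn hx hy hxy
    _ = conf κ x ^ (n - 2) * ‖∇ u x‖ ^ 2 * (1 + coshGap y x) ^ 2 *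
        (coshGap y x * (coshGap y x + 2))⁻¹ := by ring
    _ ≤ M * (‖x - y‖ ^ 2)⁻¹ := by
        gcongr
        · exact hM x
        · nlinarith

include hκ hy hu hc hs in
lemma integrableOn_radialDensity_mul (hn : 3 ≤ n) {k : ℝ → ℝ} {L : ℝ}
    (hk : ContinuousOn k (Ioi 0))
    (hkL : ∀ s, 0 < s → |k s| ≤ L * ((1 + s) ^ 2 / (s * (s + 2)))) :
    IntegrableOn (fun x => radialDensity κ y u x * k (coshGap y x)) (space n) := by
  obtain ⟨M, hM0, hM⟩ := exists_radialDensity_bound hκ hy hu hc hs (by omega)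
  -- The sign of L is read off from the assumed bound at s = 1.
  have hL : 0 ≤ L := by
    have h1 := (abs_nonneg _).trans (hkL 1 one_pos)
    norm_num at h1
    linarith
  refine integrableOn_space_of_le hn hy (M := L * M) ?_ fun x hx hxy => ?_
  · refine (continuousOn_radialDensity hκ hy hu).mul (hk.comp
      ((contDiffOn_coshGap hy).continuousOn.mono sdiff_subset) fun x hx => ?_)
    exact coshGap_pos hx.1 hy hx.2
  · rw [abs_mul, abs_of_nonneg (radialDensity_nonneg hκ hx hy)]
    calc _ ≤ radialDensity κ y u x *
          (L * ((1 + coshGap y x) ^ 2 / (coshGap y x * (coshGap y x + 2)))) := by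
          gcongr
          · exact radialDensity_nonneg hκ hx hy
          · exact hkL _ (coshGap_pos hx hy hxy)
      _ = L * (radialDensity κ y u x *
          ((1 + coshGap y x) ^ 2 / (coshGap y x * (coshGap y x + 2)))) := by ring
      _ ≤ L * (M * (‖x - y‖ ^ 2)⁻¹) := 
          mul_le_mul_of_nonneg_left (hM x hx hxy) hL
      _ = _ := by ring

include hκ hu hs in
lemma continuousOn_laplaceBeltrami : ContinuousOn (laplaceBeltrami κ u) (space n) := by
  unfold laplaceBeltrami
  refine ContinuousOn.mul (ContinuousOn.inv₀ ((contDiffOn_conf hκ).continuousOn.pow n)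
    fun x hx => (pow_pos (conf_pos hκ hx) n).ne') (Continuous.continuousOn ?_)
  have hq : ContDiffOn ℝ 1 (fun x : E n => conf κ x ^ ((n : ℤ) - 2)) (space n) := by
    intro x hx
    have hcx := ((contDiffOn_conf (n := n) hκ).of_le (m := 1) (by simp)) x hx
    have hcp := (conf_pos hκ hx).ne'
    -- Both signs of the exponent are treated, since no lower bound on n is in force here.
    rcases (n : ℤ) - 2 with k | k
    · simpa using hcx.pow k
    · simp only [zpow_negSucc]
      exact (hcx.pow (k + 1)).inv (pow_ne_zero _ hcp)
  refine continuous_euclDiv (contDiff_of_contDiffOn_space (isClosed_tsupport u) hs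
    (hq.smul ((contDiff_gradient hu).of_le (m := 1) (by simp)).contDiffOn) fun x hx => ?_)
  rw [gradient_eq_zero hx, smul_zero]

include hκ hu hc hs in
lemma integrableOn_laplaceBeltrami_sq :
    IntegrableOn (fun x => conf κ x ^ n * laplaceBeltrami κ u x ^ 2) (space n) := by
  have hco : ContinuousOn (fun x => conf κ x ^ n * laplaceBeltrami κ u x ^ 2) (space n) :=
    ((contDiffOn_conf hκ).continuousOn.pow n).mul ((continuousOn_laplaceBeltrami hκ hu hs).pow 2)
  refine ((hco.mono hs).integrableOn_compact hc.isCompact).of_forall_sdiff_eq_zero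
    isOpen_space.measurableSet fun x hx => ?_
  rw [laplaceBeltrami_eq_zero κ hx.2]
  ring

variable {f f' : ℝ → ℝ} (hf : ∀ s, 0 ≤ s → ContDiffAt ℝ 1 f s)

include hκ hy hu hs hf in
lemma contDiff_rellichField : ContDiff ℝ 1 (rellichField κ y u f) := by
  refine contDiff_of_contDiffOn_space (isClosed_tsupport u) hs ?_ fun x hx => ?_
  · have h1 := (contDiffOn_conf (n := n) hκ).of_le (m := 1) (by simp)
    have h2 := (contDiffOn_coshGap hy).of_le (m := 1) (by simp)
    have h3 := ((contDiff_confField κ y).of_le (m := 1) (by simp)).contDiffOn (s := space n)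
    have h4 := ((contDiff_gradient hu).of_le (m := 1) (by simp)).contDiffOn (s := space n)
    have h5 : ContDiffOn ℝ 1 (fun x => f (coshGap y x)) (space n) := fun x hx =>
      (hf _ (coshGap_nonneg hx hy)).comp_contDiffWithinAt x (h2 x hx)
    have h6 := h5.smul h3
    exact ((h6.inner ℝ h4).smul ((h1.pow (n - 2)).smul h4)).sub
      (((h4.norm_sq ℝ).div_const 2).smul ((h1.pow (n - 2)).smul h6))
  · simp [rellichField, gradient_eq_zero hx]

include hκ hy hu hc hs hf in
-- Twice the divergence is added to the left side at no cost; the inequality then holds pointwise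
-- off y. The condition `hpos` is the sign of the coefficient of |∇u|².
lemma integral_radialDensity_le (hn : 3 ≤ n) (hf' : ∀ s, 0 ≤ s → HasDerivAt f (f' s) s)
    (hpos : ∀ s, 0 < s → 0 ≤ ((n : ℝ) - 2) * f s * (1 + s) + f' s * (s * (s + 2)))
    (hint : IntegrableOn (fun x => radialDensity κ y u x *
      (κ ^ 2 * (((n : ℝ) - 2) * f (coshGap y x) * (1 + coshGap y x) -
        (f' (coshGap y x) + f (coshGap y x) ^ 2) * (coshGap y x * (coshGap y x + 2)))))
      (space n)) :
    ∫ x in space n, radialDensity κ y u x *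
      (κ ^ 2 * (((n : ℝ) - 2) * f (coshGap y x) * (1 + coshGap y x) -
        (f' (coshGap y x) + f (coshGap y x) ^ 2) * (coshGap y x * (coshGap y x + 2)))) ≤
      ∫ x in space n, conf κ x ^ n * laplaceBeltrami κ u x ^ 2 := by
  have hΦ := contDiff_rellichField hκ hy hu hs hf
  have h0 : ∀ x ∉ tsupport u, rellichField κ y u f x = 0 := fun x hx => by
    simp [rellichField, gradient_eq_zero hx]
  have hΦc : HasCompactSupport (rellichField κ y u f) :=
    HasCompactSupport.intro hc.isCompact h0
  have hd0 : ∀ x ∉ tsupport u, euclDiv (rellichField κ y u f) x = 0 := fun x hx => by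
    refine euclDiv_eq_zero_of_eventuallyEq ?_
    filter_upwards [(isClosed_tsupport u).isOpen_compl.mem_nhds hx] with z hz using h0 z hz
  have hdiv0 : ∫ x in space n, 2 * euclDiv (rellichField κ y u f) x = 0 := by
    rw [integral_const_mul, setIntegral_eq_integral_of_forall_compl_eq_zero
      fun x hx => hd0 x fun h => hx (hs h), integral_euclDiv hΦ hΦc, mul_zero]
  have hdivI : IntegrableOn (fun x => 2 * euclDiv (rellichField κ y u f) x) (space n) :=
    (((continuous_euclDiv hΦ).integrable_of_hasCompactSupport
      (HasCompactSupport.intro hc.isCompact hd0)).const_mul 2).integrableOn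
  rw [← zero_add (∫ x in space n, radialDensity κ y u x * _), ← hdiv0,
    ← integral_add hdivI hint]
  refine integral_mono_ae (hdivI.add hint) (integrableOn_laplaceBeltrami_sq hκ hu hc hs) ?_
  filter_upwards [ae_restrict_space_ne hn y] with x ⟨hx, hxy⟩
  have hp := conf_pos hκ hx
  have hs := coshGap_pos hx hy hxy
  have hle := radialDensity_le (u := u) hκ (by omega : 2 ≤ n) hx hy hxy
  have hD : conf κ x ^ n * inner ℝ (confField κ y x) (∇ u x) ^ 2 =
      radialDensity κ y u x * (κ ^ 2 * (coshGap y x * (coshGap y x + 2))) := by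
    rw [radialDensity]; field_simp
  simp only [euclDiv_rellichField hκ (by omega : 2 ≤ n) hx hy hu (hf' _ hs.le)]
  -- The loss from replacing the full gradient by its radial part; `hsq` below is the loss from
  -- completing the square.
  have hkey := mul_le_mul_of_nonneg_right hle (mul_nonneg (sq_nonneg κ) (hpos _ hs))
  have hsq : 0 ≤ conf κ x ^ n * (laplaceBeltrami κ u x -
      f (coshGap y x) * inner ℝ (confField κ y x) (∇ u x)) ^ 2 := by positivity
  generalize coshGap y x = s at *
  generalize inner ℝ (confField κ y x) (∇ u x) = T at *
  generalize radialDensity κ y u x = D at *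
  linear_combination hkey + hsq + (2 * f' s + f s ^ 2) * hD

end regular

/-! ### Elementary bounds for arcosh -/

lemma sinh_le_mul_cosh {t : ℝ} (ht : 0 ≤ t) : Real.sinh t ≤ t * Real.cosh t := by
  have hd (t : ℝ) : HasDerivAt (fun t => t * Real.cosh t - Real.sinh t) (t * Real.sinh t) t := by
    refine (((hasDerivAt_id t).mul (Real.hasDerivAt_cosh t)).sub
      (Real.hasDerivAt_sinh t)).congr_deriv ?_
    simp
  have hm : MonotoneOn (fun t => t * Real.cosh t - Real.sinh t) (Ici 0) := by
    refine monotoneOn_of_deriv_nonneg (convex_Ici 0)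
      (fun t _ => (hd t).continuousAt.continuousWithinAt)
      (fun t _ => (hd t).differentiableAt.differentiableWithinAt) fun t ht => ?_
    rw [interior_Ici] at ht
    rw [(hd t).deriv]
    exact mul_nonneg (le_of_lt ht) (Real.sinh_nonneg_iff.2 (le_of_lt ht))
  have := hm self_mem_Ici ht ht
  simp at this
  linarith

section arcosh

variable {s : ℝ} (hs : 0 < s)
include hs

lemma sqrt_one_add_sq_sub_one_pos : 0 < √((1 + s) ^ 2 - 1) := Real.sqrt_pos.2 (by nlinarith)

lemma sq_sqrt_one_add_sq_sub_one : √((1 + s) ^ 2 - 1) ^ 2 = s * (s + 2) := by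
  rw [Real.sq_sqrt (by nlinarith)]
  ring

lemma arcosh_one_add_pos : 0 < Real.arcosh (1 + s) := Real.arcosh_pos (by linarith)

lemma sqrt_le_arcosh_mul : √((1 + s) ^ 2 - 1) ≤ Real.arcosh (1 + s) * (1 + s) := by
  have := sinh_le_mul_cosh (arcosh_one_add_pos hs).le
  rwa [Real.sinh_arcosh (by linarith), Real.cosh_arcosh (by linarith)] at this

end arcosh

/-! ### The radial profile -/

/-- `(a coth ψ + h / ψ) / sinh ψ` for `ψ = arcosh (1 + s)`. -/
def profile (a h s : ℝ) : ℝ :=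
  a * ((1 + s) / (s * (s + 2))) + h * (Real.arcosh (1 + s) * √((1 + s) ^ 2 - 1))⁻¹

/-- The derivative of `profile a h`. -/
def profileDeriv (a h s : ℝ) : ℝ :=
  -(a * ((1 + (1 + s) ^ 2) / (s * (s + 2)) ^ 2) +
    h * ((Real.arcosh (1 + s) ^ 2 * (s * (s + 2)))⁻¹ +
      (1 + s) / (Real.arcosh (1 + s) * √((1 + s) ^ 2 - 1) * (s * (s + 2)))))

section profile

variable {a h s : ℝ}

lemma hasDerivAt_profile (hs : 0 < s) : HasDerivAt (profile a h) (profileDeriv a h s) s := by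
  have hS := sqrt_one_add_sq_sub_one_pos hs
  have hψ := arcosh_one_add_pos hs
  have hS2 := sq_sqrt_one_add_sq_sub_one hs
  have e1 : HasDerivAt (fun s : ℝ => 1 + s) 1 s := (hasDerivAt_id s).const_add 1
  have e2 : HasDerivAt (fun s : ℝ => s * (s + 2)) (1 * (s + 2) + s * 1) s :=
    (hasDerivAt_id s).mul ((hasDerivAt_id s).add_const 2)
  have e3 : HasDerivAt (fun s : ℝ => Real.arcosh (1 + s)) _ s :=
    (Real.hasDerivAt_arcosh (show 1 + s ∈ Ioi 1 by simp [hs])).comp s e1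
  have e4 : HasDerivAt (fun s : ℝ => √((1 + s) ^ 2 - 1)) _ s :=
    ((e1.fun_pow 2).sub_const 1).sqrt (by nlinarith)
  have e5 := ((e1.fun_div e2 (by positivity)).const_mul a).fun_add
    (((e3.fun_mul e4).fun_inv (by positivity)).const_mul h)
  refine HasDerivAt.congr_deriv e5 ?_
  unfold profileDeriv
  rw [← hS2]
  rw [show (1 * (s + 2) + s * 1) = 2 * (1 + s) by ring]
  have hS3 : (1 + s) ^ 2 = √((1 + s) ^ 2 - 1) ^ 2 + 1 := by rw [hS2]; ring
  generalize √((1 + s) ^ 2 - 1) = S at *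
  generalize Real.arcosh (1 + s) = ψ at *
  field_simp
  simp only [Nat.cast_ofNat, Nat.add_one_sub_one, pow_one]
  linear_combination (-(2 * a * ψ ^ 2)) * hS3

lemma contDiffAt_profile (hs : 0 < s) : ContDiffAt ℝ 1 (profile a h) s := by
  have hS := sqrt_one_add_sq_sub_one_pos hs
  have hψ := arcosh_one_add_pos hs
  unfold profile
  have e1 : ContDiffAt ℝ 1 (fun s : ℝ => 1 + s) s := by fun_prop
  have e3 : ContDiffAt ℝ 1 (fun s : ℝ => Real.arcosh (1 + s)) s :=
    (Real.contDiffAt_arcosh (show 1 + s ∈ Ioi 1 by simp [hs])).comp s e1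
  have e4 : ContDiffAt ℝ 1 (fun s : ℝ => √((1 + s) ^ 2 - 1)) s :=
    ((e1.pow 2).sub contDiffAt_const).sqrt (by nlinarith)
  have e2 : ContDiffAt ℝ 1 (fun s : ℝ => s * (s + 2)) s := by fun_prop
  exact (contDiffAt_const.mul (e1.div e2 (by positivity))).add
    (contDiffAt_const.mul ((e3.mul e4).inv (by positivity)))

lemma continuousOn_arcosh_one_add : ContinuousOn (fun s : ℝ => Real.arcosh (1 + s)) (Ioi 0) :=
  Real.continuousOn_arcosh.comp (by fun_prop) fun t ht => by
    simp only [mem_Ioi, mem_Ici] at *; linarith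

lemma continuousOn_profile : ContinuousOn (profile a h) (Ioi 0) := fun _ hs =>
  (contDiffAt_profile hs).continuousAt.continuousWithinAt

lemma continuousOn_profileDeriv : ContinuousOn (profileDeriv a h) (Ioi 0) := by
  have h1 := continuousOn_arcosh_one_add
  have h2 : ContinuousOn (fun s : ℝ => √((1 + s) ^ 2 - 1)) (Ioi 0) := by fun_prop
  have h3 : ContinuousOn (fun s : ℝ => s * (s + 2)) (Ioi 0) := by fun_prop
  have h4 : ContinuousOn (fun s : ℝ => 1 + s) (Ioi 0) := by fun_prop
  have hp : ∀ s ∈ Ioi (0 : ℝ), 0 < s * (s + 2) := fun s hs => by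
    simp only [mem_Ioi] at hs; positivity
  have hψ : ∀ s ∈ Ioi (0 : ℝ), 0 < Real.arcosh (1 + s) := fun s hs => arcosh_one_add_pos hs
  have hS : ∀ s ∈ Ioi (0 : ℝ), 0 < √((1 + s) ^ 2 - 1) := fun s hs =>
    sqrt_one_add_sq_sub_one_pos hs
  unfold profileDeriv
  refine ((continuousOn_const.mul ((continuousOn_const.add (h4.pow 2)).div (h3.pow 2) ?_)).add
    (continuousOn_const.mul ((((h1.pow 2).mul h3).inv₀ ?_).add
      (h4.div ((h1.mul h2).mul h3) ?_)))).neg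
  · exact fun s hs => (pow_pos (hp s hs) 2).ne'
  · exact fun s hs => (mul_pos (pow_pos (hψ s hs) 2) (hp s hs)).ne'
  · exact fun s hs => (mul_pos (mul_pos (hψ s hs) (hS s hs)) (hp s hs)).ne'

/-- With ψ = arcosh(1 + s) this is tanh ψ ≤ ψ, which lets cosh ψ/sinh² ψ dominate 1/(ψ sinh ψ). -/
lemma inv_arcosh_mul_sqrt_le (hs : 0 < s) :
    (Real.arcosh (1 + s) * √((1 + s) ^ 2 - 1))⁻¹ ≤ (1 + s) / (s * (s + 2)) := by
  have hS := sqrt_one_add_sq_sub_one_pos hs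
  have hψ := arcosh_one_add_pos hs
  have hS2 := sq_sqrt_one_add_sq_sub_one hs
  have hle := sqrt_le_arcosh_mul hs
  rw [← hS2, inv_eq_one_div, div_le_div_iff₀ (by positivity) (by positivity)]
  nlinarith

lemma inv_arcosh_sq_le (hs : 0 < s) :
    (Real.arcosh (1 + s) ^ 2)⁻¹ ≤ (1 + s) ^ 2 / (s * (s + 2)) := by
  have hS := sqrt_one_add_sq_sub_one_pos hs
  have hψ := arcosh_one_add_pos hs
  have hS2 := sq_sqrt_one_add_sq_sub_one hs
  have hle := sqrt_le_arcosh_mul hs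
  rw [← hS2, inv_eq_one_div, div_le_div_iff₀ (by positivity) (by positivity)]
  have := pow_le_pow_left₀ hS.le hle 2
  linarith

lemma one_add_div_le (hs : 0 < s) : (1 + s) / (s * (s + 2)) ≤ 1 / s := by
  rw [div_le_div_iff₀ (by positivity) (by positivity)]
  nlinarith

variable (ha : 0 ≤ a) (hh : 0 ≤ h)
include ha hh

lemma profile_nonneg (hs : 0 < s) : 0 ≤ profile a h s := by
  have hψ := arcosh_one_add_pos hs
  unfold profile
  positivity

lemma profile_le (hs : 0 < s) : profile a h s ≤ (a + h) / s := by
  have h1 := one_add_div_le hs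
  have h2 := (inv_arcosh_mul_sqrt_le hs).trans h1
  calc profile a h s ≤ a * (1 / s) + h * (1 / s) := by unfold profile; gcongr
    _ = _ := by ring

lemma profileDeriv_nonpos (hs : 0 < s) : profileDeriv a h s ≤ 0 := by
  have hψ := arcosh_one_add_pos hs
  unfold profileDeriv
  rw [neg_nonpos]
  positivity

lemma neg_profileDeriv_le (hs : 0 < s) : -profileDeriv a h s ≤ 2 * (a + h) / s ^ 2 := by
  have hψ := arcosh_one_add_pos hs
  have hS := sqrt_one_add_sq_sub_one_pos hs
  have h1 : ((1 + s) / (s * (s + 2))) ^ 2 ≤ (1 / s) ^ 2 := by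
    have := one_add_div_le hs
    gcongr
  have hA : (1 + (1 + s) ^ 2) / (s * (s + 2)) ^ 2 ≤ 2 * (1 / s) ^ 2 := by
    calc (1 + (1 + s) ^ 2) / (s * (s + 2)) ^ 2 ≤ 2 * ((1 + s) / (s * (s + 2))) ^ 2 := by
          rw [div_pow, mul_div_assoc']
          gcongr
          nlinarith
      _ ≤ _ := by gcongr
  have hB : (Real.arcosh (1 + s) ^ 2 * (s * (s + 2)))⁻¹ ≤ (1 / s) ^ 2 := by
    calc (Real.arcosh (1 + s) ^ 2 * (s * (s + 2)))⁻¹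
        = (Real.arcosh (1 + s) ^ 2)⁻¹ * (s * (s + 2))⁻¹ := mul_inv _ _
      _ ≤ (1 + s) ^ 2 / (s * (s + 2)) * (s * (s + 2))⁻¹ := by
          gcongr; exact inv_arcosh_sq_le hs
      _ = ((1 + s) / (s * (s + 2))) ^ 2 := by ring
      _ ≤ _ := h1
  have hC : (1 + s) / (Real.arcosh (1 + s) * √((1 + s) ^ 2 - 1) * (s * (s + 2))) ≤
      (1 / s) ^ 2 := by
    calc (1 + s) / (Real.arcosh (1 + s) * √((1 + s) ^ 2 - 1) * (s * (s + 2)))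
        = (Real.arcosh (1 + s) * √((1 + s) ^ 2 - 1))⁻¹ * ((1 + s) / (s * (s + 2))) := by
          field_simp
      _ ≤ (1 + s) / (s * (s + 2)) * ((1 + s) / (s * (s + 2))) := by
          gcongr; exact inv_arcosh_mul_sqrt_le hs
      _ = ((1 + s) / (s * (s + 2))) ^ 2 := by ring
      _ ≤ _ := h1
  calc -profileDeriv a h s ≤ a * (2 * (1 / s) ^ 2) + h * ((1 / s) ^ 2 + (1 / s) ^ 2) := by
        unfold profileDeriv
        rw [neg_neg]
        gcongr
    _ = _ := by ring

/-- In terms of Φ, up to the factor 1/sinh² ψ, this is (N - 3) Φ coth ψ + Φ' ≥ 0. The a-part needs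
(N - 3) cosh² ψ ≥ 1, and the h-part needs (N - 3) coth ψ ≥ 1/ψ, which follows from tanh ψ ≤ ψ. -/
lemma profile_riccati_nonneg {N : ℝ} (hN : 5 ≤ N) (hs : 0 < s) :
    0 ≤ (N - 2) * profile a h s * ((1 + s) / (s * (s + 2))) + profileDeriv a h s := by
  have hψ := arcosh_one_add_pos hs
  have hS := sqrt_one_add_sq_sub_one_pos hs
  have hS2 := sq_sqrt_one_add_sq_sub_one hs
  have hle := inv_arcosh_mul_sqrt_le hs
  have key : (N - 2) * profile a h s * ((1 + s) / (s * (s + 2))) + profileDeriv a h s =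
      a * (((N - 3) * (1 + s) ^ 2 - 1) / (s * (s + 2)) ^ 2) +
      h * ((Real.arcosh (1 + s) * √((1 + s) ^ 2 - 1))⁻¹ * ((N - 3) * ((1 + s) / (s * (s + 2))) -
        (Real.arcosh (1 + s) * √((1 + s) ^ 2 - 1))⁻¹)) := by
    unfold profile profileDeriv
    rw [← hS2]
    field_simp
    ring
  rw [key]
  have hb : 0 ≤ (1 + s) / (s * (s + 2)) := by positivity
  have h1 : 0 ≤ (N - 3) * (1 + s) ^ 2 - 1 := by nlinarith
  have h2 : 0 ≤ (N - 3) * ((1 + s) / (s * (s + 2))) -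
      (Real.arcosh (1 + s) * √((1 + s) ^ 2 - 1))⁻¹ := by nlinarith
  positivity

/-- The ratio (1 + s)/(s (s + 2)) decreases in s, so its value at s dominates the one at s + ε and
the unshifted inequality carries over. -/
lemma profile_shift_nonneg {N ε : ℝ} (hN : 5 ≤ N) (hs : 0 < s) (hε : 0 ≤ ε) :
    0 ≤ (N - 2) * profile a h (s + ε) * (1 + s) + profileDeriv a h (s + ε) * (s * (s + 2)) := by
  have ht : 0 < s + ε := by linarith
  have h1 := profile_riccati_nonneg ha hh hN ht
  have h2 : (1 + (s + ε)) / ((s + ε) * (s + ε + 2)) ≤ (1 + s) / (s * (s + 2)) := by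
    rw [div_le_div_iff₀ (by positivity) (by positivity)]
    nlinarith [mul_nonneg hε hs.le, mul_nonneg (mul_nonneg hε hs.le) hs.le,
      mul_nonneg (mul_nonneg hε hs.le) hε]
  have h3 : 0 ≤ (N - 2) * profile a h (s + ε) :=
    mul_nonneg (by linarith) (profile_nonneg ha hh ht)
  have h4 : 0 ≤ (N - 2) * profile a h (s + ε) * ((1 + s) / (s * (s + 2))) +
      profileDeriv a h (s + ε) := by
    linarith [mul_le_mul_of_nonneg_left h2 h3]
  have h5 := mul_nonneg h4 (show 0 ≤ s * (s + 2) by positivity)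
  refine h5.trans_eq ?_
  field_simp

end profile

/-! ### The weight and removal of the regularization -/

/-- The weight produced by `profile a h (· + ε)` in the Rellich inequality. -/
def profileWeight (N κ a h ε s : ℝ) : ℝ :=
  κ ^ 2 * ((N - 2) * profile a h (s + ε) * (1 + s) -
    (profileDeriv a h (s + ε) + profile a h (s + ε) ^ 2) * (s * (s + 2)))

lemma continuousOn_profileWeight {N κ a h ε : ℝ} (hε : 0 ≤ ε) :
    ContinuousOn (profileWeight N κ a h ε) (Ioi 0) := by
  have hm : MapsTo (fun s : ℝ => s + ε) (Ioi 0) (Ioi 0) := fun s (hs : 0 < s) => by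
    simp only [mem_Ioi]; linarith
  have h1 : ContinuousOn (fun s => profile a h (s + ε)) (Ioi 0) :=
    continuousOn_profile.comp (by fun_prop) hm
  have h2 : ContinuousOn (fun s => profileDeriv a h (s + ε)) (Ioi 0) :=
    continuousOn_profileDeriv.comp (by fun_prop) hm
  unfold profileWeight
  fun_prop

/-- The profile is at most (a + h)/t and its derivative at most 2(a + h)/t² in size; replacing t = s
+ ε by s makes the bound uniform in ε, as dominated convergence requires. -/
lemma abs_profileWeight_le {N κ a h ε s : ℝ} (hN : 2 ≤ N) (ha : 0 ≤ a) (hh : 0 ≤ h) (hε : 0 ≤ ε)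
    (hs : 0 < s) :
    |profileWeight N κ a h ε s| ≤
      κ ^ 2 * (2 * (N - 2) * (a + h) + 8 * (a + h) + 4 * (a + h) ^ 2) *
        ((1 + s) ^ 2 / (s * (s + 2))) := by
  have ht : 0 < s + ε := by linarith
  have hN2 : 0 ≤ N - 2 := by linarith
  have f0 := profile_nonneg ha hh ht
  have f1 : profile a h (s + ε) ≤ (a + h) / s := (profile_le ha hh ht).trans (by gcongr; linarith)
  have g0 := profileDeriv_nonpos ha hh ht
  have g1 : -profileDeriv a h (s + ε) ≤ 2 * (a + h) / s ^ 2 :=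
    (neg_profileDeriv_le ha hh ht).trans (by gcongr; linarith)
  rw [profileWeight, abs_mul, abs_of_nonneg (sq_nonneg κ), mul_assoc (κ ^ 2)]
  refine mul_le_mul_of_nonneg_left ?_ (sq_nonneg κ)
  generalize profile a h (s + ε) = F at *
  generalize profileDeriv a h (s + ε) = G at *
  have hA : 0 ≤ a + h := by linarith
  generalize a + h = A at *
  have hQ : 0 < s * (s + 2) := by positivity
  calc |(N - 2) * F * (1 + s) - (G + F ^ 2) * (s * (s + 2))|
      ≤ (N - 2) * F * (1 + s) + (-G + F ^ 2) * (s * (s + 2)) := by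
        have h1 : 0 ≤ (N - 2) * F * (1 + s) := by positivity
        have h2 : 0 ≤ -G * (s * (s + 2)) := mul_nonneg (by linarith) hQ.le
        have h3 : 0 ≤ F ^ 2 * (s * (s + 2)) := by positivity
        rw [abs_le]
        constructor <;> linarith
    _ ≤ (N - 2) * (A / s) * (1 + s) + (2 * A / s ^ 2 + (A / s) ^ 2) * (s * (s + 2)) := by
        gcongr
    _ = ((N - 2) * A * ((1 + s) * (s + 2)) + (2 * A + A ^ 2) * (s + 2) ^ 2) /
        (s * (s + 2)) := by field_simp
    _ ≤ ((N - 2) * A * ((1 + s) * (2 * (1 + s))) + (2 * A + A ^ 2) * (2 * (1 + s)) ^ 2) /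
        (s * (s + 2)) := by gcongr <;> linarith
    _ = _ := by ring

/-- Expand the Riccati expression using coth² = 1 + 1/sinh². The constant term is a (N - 1 - a), the
coefficient of 1/sinh² is a (N - a), and that of coth ψ/ψ is h (N - 1 - 2a) = h (2h - 1). The
remaining (h - h²)/ψ² is split as h² - (2h - 1) h to form the weight (ψ coth ψ - 1)/ψ². -/
lemma profileWeight_zero {N κ a h s : ℝ} (ha : a = N / 2 - h) (hs : 0 < s) :
    profileWeight N κ a h 0 s =
      κ ^ 2 * (((N - 1) ^ 2 - (2 * h - 1) ^ 2) / 4) + h ^ 2 * (κ ^ 2 / Real.arcosh (1 + s) ^ 2) +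
      κ ^ 2 * (N ^ 2 / 4 - h ^ 2) * (1 / (s * (s + 2))) +
      (2 * h - 1) * h * (κ ^ 2 * (Real.arcosh (1 + s) * (1 + s) / √((1 + s) ^ 2 - 1) - 1) /
        Real.arcosh (1 + s) ^ 2) := by
  have hψ := arcosh_one_add_pos hs
  have hS := sqrt_one_add_sq_sub_one_pos hs
  have hS2 := sq_sqrt_one_add_sq_sub_one hs
  subst ha
  simp only [profileWeight, profile, profileDeriv, add_zero]
  have hC : (1 + s) ^ 2 = √((1 + s) ^ 2 - 1) ^ 2 + 1 := by rw [hS2]; ring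
  rw [← hS2]
  generalize √((1 + s) ^ 2 - 1) = S at *
  generalize Real.arcosh (1 + s) = ψ at *
  generalize 1 + s = C at *
  field_simp
  linear_combination (κ ^ 2 * 4 * ψ ^ 2 * (2 * (N - 2) * (N - 2 * h) + 2 * (N - 2 * h) -
    (N - 2 * h) ^ 2)) * hC

lemma integral_radialDensity_mul_profileWeight_le {κ : ℝ} (hκ : 0 < κ) {y : E n}
    (hy : y ∈ space n) {u : E n → ℝ} (hu : ContDiff ℝ ∞ u) (hc : HasCompactSupport u)
    (hs : tsupport u ⊆ space n) (hn : 5 ≤ n) {a h : ℝ} (ha : 0 ≤ a) (hh : 0 ≤ h) :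
    ∫ x in space n, radialDensity κ y u x * profileWeight n κ a h 0 (coshGap y x) ≤
      ∫ x in space n, conf κ x ^ n * laplaceBeltrami κ u x ^ 2 := by
  have hN : (5 : ℝ) ≤ n := by exact_mod_cast hn
  have hint {ε : ℝ} (hε : 0 ≤ ε) : IntegrableOn
      (fun x => radialDensity κ y u x * profileWeight n κ a h ε (coshGap y x)) (space n) :=
    integrableOn_radialDensity_mul hκ hy hu hc hs (by omega) (continuousOn_profileWeight hε)
      fun s hs => abs_profileWeight_le (by linarith) ha hh hε hs
  obtain ⟨M, hM0, hM⟩ := exists_radialDensity_bound hκ hy hu hc hs (by omega)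
  obtain ⟨L, hL⟩ : ∃ L, L = κ ^ 2 *
    (2 * ((n : ℝ) - 2) * (a + h) + 8 * (a + h) + 4 * (a + h) ^ 2) := ⟨_, rfl⟩
  have hL0 : 0 ≤ L := by
    have : 0 ≤ (n : ℝ) - 2 := by linarith
    rw [hL]; positivity
  have hlim : Tendsto (fun m : ℕ => ∫ x in space n, radialDensity κ y u x *
      profileWeight n κ a h (1 / ((m : ℝ) + 1)) (coshGap y x)) atTop
      (𝓝 (∫ x in space n, radialDensity κ y u x * profileWeight n κ a h 0 (coshGap y x))) := by
    refine tendsto_integral_of_dominated_convergence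
      (fun x => L * (M * (‖x - y‖ ^ 2)⁻¹))
      (fun m => (hint (by positivity)).aestronglyMeasurable)
      (((integrableOn_inv_norm_sub_sq (by omega) hy).const_mul M).const_mul L) (fun m => ?_) ?_
    · filter_upwards [ae_restrict_space_ne (by omega) y] with x ⟨hx, hxy⟩
      have hD := radialDensity_nonneg (u := u) hκ hx hy
      rw [Real.norm_eq_abs, abs_mul, abs_of_nonneg hD]
      calc _ ≤ radialDensity κ y u x *
            (L * ((1 + coshGap y x) ^ 2 / (coshGap y x * (coshGap y x + 2)))) := by
            gcongr
            rw [hL]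
            exact abs_profileWeight_le (by linarith) ha hh (by positivity)
              (coshGap_pos hx hy hxy)
        _ = L * (radialDensity κ y u x *
            ((1 + coshGap y x) ^ 2 / (coshGap y x * (coshGap y x + 2)))) := by ring
        _ ≤ L * (M * (‖x - y‖ ^ 2)⁻¹) := mul_le_mul_of_nonneg_left (hM x hx hxy) hL0
    · filter_upwards [ae_restrict_space_ne (by omega) y] with x ⟨hx, hxy⟩
      have hs := coshGap_pos hx hy hxy
      have ht : Tendsto (fun m : ℕ => coshGap y x + 1 / ((m : ℝ) + 1)) atTop
          (𝓝 (coshGap y x + 0)) := tendsto_one_div_add_atTop_nhds_zero_nat.const_add _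
      have hmem : Ioi (0 : ℝ) ∈ 𝓝 (coshGap y x + 0) := Ioi_mem_nhds (by simpa using hs)
      have h1 := (continuousOn_profile (a := a) (h := h).continuousAt hmem).tendsto.comp ht
      have h2 := (continuousOn_profileDeriv (a := a) (h := h).continuousAt hmem).tendsto.comp ht
      exact ((((h1.const_mul _).mul_const _).sub
        ((h2.add (h1.pow 2)).mul_const _)).const_mul _).const_mul _
  -- For each positive ε the shifted profile is C¹ on s ≥ 0, so the weighted Rellich inequality
  -- applies.
  refine le_of_tendsto hlim (Eventually.of_forall fun m => ?_)
  have hε : (0 : ℝ) < 1 / ((m : ℝ) + 1) := by positivity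
  refine integral_radialDensity_le hκ hy hu hc hs
    (f := fun s => profile a h (s + 1 / ((m : ℝ) + 1)))
    (f' := fun s => profileDeriv a h (s + 1 / ((m : ℝ) + 1)))
    (fun s hs => ?_) (by omega) (fun s hs => ?_) (fun s hs => ?_) (hint hε.le)
  · have hp : 0 < s + 1 / ((m : ℝ) + 1) := by linarith
    have hsh : ContDiffAt ℝ 1 (fun s : ℝ => s + 1 / ((m : ℝ) + 1)) s := by fun_prop
    exact (contDiffAt_profile (a := a) (h := h) hp).comp s hsh
  · simpa using (hasDerivAt_profile (a := a) (h := h) (s := s + 1 / ((m : ℝ) + 1))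
      (by linarith)).comp_add_const s _
  · exact profile_shift_nonneg ha hh hN hs hε.le

/-! ### Passage to the hyperbolic volume and bounds for the weights -/

lemma measurable_conf (κ : ℝ) : Measurable (conf (n := n) κ) := by
  unfold conf
  fun_prop

lemma integrable_vol {κ : ℝ} (hκ : 0 < κ) {g : E n → ℝ}
    (hg : IntegrableOn (fun x => conf κ x ^ n * g x) (space n)) : Integrable g (vol n κ) := by
  rw [vol, integrable_withDensity_iff_integrable_smul']
  · refine hg.congr ?_
    filter_upwards [ae_restrict_mem isOpen_space.measurableSet] with x hx
    rw [ENNReal.toReal_ofReal (pow_nonneg (conf_pos hκ hx).le n), smul_eq_mul]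
  · exact ((measurable_conf κ).pow_const n).ennreal_ofReal
  · exact Eventually.of_forall fun _ => ENNReal.ofReal_lt_top

lemma setIntegral_vol {κ : ℝ} (hκ : 0 < κ) {Ω : Set (E n)} {g : E n → ℝ}
    (h0 : ∀ x ∉ Ω, g x = 0) :
    ∫ x in Ω, g x ∂(vol n κ) = ∫ x in space n, conf κ x ^ n * g x := by
  rw [setIntegral_eq_integral_of_forall_compl_eq_zero h0, vol,
    integral_withDensity_eq_integral_toReal_smul
      ((measurable_conf κ).pow_const n).ennreal_ofReal
      (Eventually.of_forall fun _ => ENNReal.ofReal_lt_top)]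
  refine integral_congr_ae ?_
  filter_upwards [ae_restrict_mem isOpen_space.measurableSet] with x hx
  rw [ENNReal.toReal_ofReal (pow_nonneg (conf_pos hκ hx).le n), smul_eq_mul]

lemma conf_mul_radialDeriv_sq {κ : ℝ} (hκ : 0 < κ) {x y : E n} (hx : x ∈ space n)
    (hy : y ∈ space n) (hxy : x ≠ y) (u : E n → ℝ) :
    conf κ x ^ n * |radialDeriv κ y u x| ^ 2 = radialDensity κ y u x := by
  have hs := coshGap_pos hx hy hxy
  rw [sq_abs, radialDeriv_eq hκ hx hy hxy, div_pow, mul_pow, sq_sqrt_one_add_sq_sub_one hs,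
    radialDensity, real_inner_comm, mul_div_assoc]

section weights

variable {κ : ℝ}

lemma continuousOn_inv_arcosh_sq : ContinuousOn (fun s : ℝ => κ ^ 2 / Real.arcosh (1 + s) ^ 2)
    (Ioi 0) :=
  continuousOn_const.div (continuousOn_arcosh_one_add.pow 2)
    fun _ hs => (pow_pos (arcosh_one_add_pos hs) 2).ne'

lemma continuousOn_inv_sinh_sq : ContinuousOn (fun s : ℝ => 1 / (s * (s + 2))) (Ioi 0) :=
  continuousOn_const.div (by fun_prop) fun s (hs : 0 < s) => by positivity

lemma continuousOn_coth_weight :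
    ContinuousOn (fun s : ℝ => κ ^ 2 * (Real.arcosh (1 + s) * (1 + s) / √((1 + s) ^ 2 - 1) - 1) /
      Real.arcosh (1 + s) ^ 2) (Ioi 0) := by
  have h1 := continuousOn_arcosh_one_add
  refine ContinuousOn.div (continuousOn_const.mul (((h1.mul (by fun_prop)).div (by fun_prop)
    fun s hs => (sqrt_one_add_sq_sub_one_pos hs).ne').sub continuousOn_const)) (h1.pow 2)
    fun _ hs => (pow_pos (arcosh_one_add_pos hs) 2).ne'

variable {s : ℝ} (hs : 0 < s)
include hs

lemma one_le_weight_bound : |(1 : ℝ)| ≤ 1 * ((1 + s) ^ 2 / (s * (s + 2))) := by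
  rw [abs_one, one_mul, one_le_div (by positivity)]
  nlinarith

lemma inv_arcosh_sq_weight_bound :
    |κ ^ 2 / Real.arcosh (1 + s) ^ 2| ≤ κ ^ 2 * ((1 + s) ^ 2 / (s * (s + 2))) := by
  rw [abs_of_nonneg (by positivity), div_eq_mul_inv]
  gcongr
  exact inv_arcosh_sq_le hs

lemma inv_sinh_sq_weight_bound :
    |1 / (s * (s + 2))| ≤ 1 * ((1 + s) ^ 2 / (s * (s + 2))) := by
  rw [abs_of_nonneg (by positivity), one_mul]
  gcongr
  nlinarith

lemma coth_weight_bound :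
    |κ ^ 2 * (Real.arcosh (1 + s) * (1 + s) / √((1 + s) ^ 2 - 1) - 1) /
      Real.arcosh (1 + s) ^ 2| ≤ κ ^ 2 * ((1 + s) ^ 2 / (s * (s + 2))) := by
  have hS := sqrt_one_add_sq_sub_one_pos hs
  have hψ := arcosh_one_add_pos hs
  have hle := sqrt_le_arcosh_mul hs
  have h1 : 0 ≤ Real.arcosh (1 + s) * (1 + s) / √((1 + s) ^ 2 - 1) - 1 := by
    rw [sub_nonneg, one_le_div hS]; exact hle
  rw [abs_of_nonneg (by positivity), mul_div_assoc]
  refine mul_le_mul_of_nonneg_left ?_ (sq_nonneg κ)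
  calc (Real.arcosh (1 + s) * (1 + s) / √((1 + s) ^ 2 - 1) - 1) / Real.arcosh (1 + s) ^ 2
      ≤ (Real.arcosh (1 + s) * (1 + s) / √((1 + s) ^ 2 - 1)) / Real.arcosh (1 + s) ^ 2 := by
        gcongr; linarith
    _ = (1 + s) * (Real.arcosh (1 + s) * √((1 + s) ^ 2 - 1))⁻¹ := by field_simp
    _ ≤ (1 + s) * ((1 + s) / (s * (s + 2))) := by
        gcongr; exact inv_arcosh_mul_sqrt_le hs
    _ = _ := by ring

end weights

end HypSpace

end

theorem theorem4p5 (n : ℕ) (hn : 5 ≤ n) (κ : ℝ) (hκ : 0 < κ)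
    (Ω : Set (HypSpace.E n)) (hΩ : IsOpen Ω) (hΩs : Ω ⊆ HypSpace.space n)
    (x₀ : HypSpace.E n) (hx₀ : x₀ ∈ Ω)
    (ρ : HypSpace.E n → ℝ) (hρ : ρ = HypSpace.rdist κ x₀)
    (lam : ℝ) (hlam0 : 0 ≤ lam) (hlam1 : lam ≤ ((n : ℝ) - 1) ^ 2 / 4)
    (u : HypSpace.E n → ℝ) (hu : HypSpace.IsTestFunction Ω u) :
    -- all five integrals converge
    (IntegrableOn (fun x => |HypSpace.laplaceBeltrami κ u x| ^ 2) Ω (HypSpace.vol n κ) ∧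
      IntegrableOn (fun x => |HypSpace.radialDeriv κ x₀ u x| ^ 2) Ω (HypSpace.vol n κ) ∧
      IntegrableOn (fun x => |HypSpace.radialDeriv κ x₀ u x| ^ 2 / ρ x ^ 2) Ω
        (HypSpace.vol n κ) ∧
      IntegrableOn (fun x => |HypSpace.radialDeriv κ x₀ u x| ^ 2 / Real.sinh (κ * ρ x) ^ 2) Ω
        (HypSpace.vol n κ) ∧
      IntegrableOn (fun x => (ρ x * HypSpace.ct κ (ρ x) - 1) / ρ x ^ 2
        * |HypSpace.radialDeriv κ x₀ u x| ^ 2) Ω (HypSpace.vol n κ)) ∧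
    κ ^ 2 * lam * (∫ x in Ω, |HypSpace.radialDeriv κ x₀ u x| ^ 2 ∂HypSpace.vol n κ)
      + HypSpace.hCoef n lam ^ 2
        * (∫ x in Ω, |HypSpace.radialDeriv κ x₀ u x| ^ 2 / ρ x ^ 2 ∂HypSpace.vol n κ)
      + κ ^ 2 * ((n : ℝ) ^ 2 / 4 - HypSpace.hCoef n lam ^ 2)
        * (∫ x in Ω, |HypSpace.radialDeriv κ x₀ u x| ^ 2 / Real.sinh (κ * ρ x) ^ 2
            ∂HypSpace.vol n κ)
      + HypSpace.gam n lam * HypSpace.hCoef n lam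
        * (∫ x in Ω, (ρ x * HypSpace.ct κ (ρ x) - 1) / ρ x ^ 2
            * |HypSpace.radialDeriv κ x₀ u x| ^ 2 ∂HypSpace.vol n κ)
      ≤ ∫ x in Ω, |HypSpace.laplaceBeltrami κ u x| ^ 2 ∂HypSpace.vol n κ := by
  open HypSpace in
  have hy := hΩs hx₀
  obtain ⟨hu, hc, hsΩ⟩ := hu
  have hs := hsΩ.trans hΩs
  have hN : (5 : ℝ) ≤ n := by exact_mod_cast hn
  have hγ0 : 0 ≤ gam n lam := Real.sqrt_nonneg _
  have hγ2 : gam n lam ^ 2 = ((n : ℝ) - 1) ^ 2 - 4 * lam := Real.sq_sqrt (by linarith)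
  have hγ1 : gam n lam ≤ (n : ℝ) - 1 := by
    refine le_of_sq_le_sq ?_ (by linarith)
    linarith
  have hh : gam n lam = 2 * hCoef n lam - 1 := by rw [hCoef]; ring
  have hh0 : 0 ≤ hCoef n lam := by rw [hCoef]; linarith
  -- Nonnegativity of a is equivalent to γ ≤ n - 1, that is, to λ ≥ 0.
  have ha0 : 0 ≤ (n : ℝ) / 2 - hCoef n lam := by rw [hCoef]; linarith
  have hrad0 (x : E n) (hx : x ∉ Ω) : radialDeriv κ x₀ u x = 0 :=
    radialDeriv_eq_zero κ x₀ fun h => hx (hsΩ h)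
  -- the integrands in terms of `coshGap`
  have hρx {x : E n} (hx : x ∈ space n) (hxy : x ≠ x₀) :
      κ * ρ x = Real.arcosh (1 + coshGap x₀ x) := by
    rw [hρ, rdist_eq hκ hx hy hxy]; field_simp
  have hae := ae_restrict_space_ne (by omega : 3 ≤ n) x₀
  have e1 : (fun x => conf κ x ^ n * |radialDeriv κ x₀ u x| ^ 2)
      =ᵐ[volume.restrict (space n)] fun x => radialDensity κ x₀ u x * 1 := by
    filter_upwards [hae] with x ⟨hx, hxy⟩
    rw [conf_mul_radialDeriv_sq hκ hx hy hxy, mul_one]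
  have e2 : (fun x => conf κ x ^ n * (|radialDeriv κ x₀ u x| ^ 2 / ρ x ^ 2))
      =ᵐ[volume.restrict (space n)] fun x => radialDensity κ x₀ u x *
        (κ ^ 2 / Real.arcosh (1 + coshGap x₀ x) ^ 2) := by
    filter_upwards [hae] with x ⟨hx, hxy⟩
    have := arcosh_one_add_pos (coshGap_pos hx hy hxy)
    rw [← hρx hx hxy] at this ⊢
    have hρ0 : 0 < ρ x := pos_of_mul_pos_right this hκ.le
    rw [← conf_mul_radialDeriv_sq hκ hx hy hxy]
    field_simp
  have e3 : (fun x => conf κ x ^ n * (|radialDeriv κ x₀ u x| ^ 2 / Real.sinh (κ * ρ x) ^ 2))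
      =ᵐ[volume.restrict (space n)] fun x => radialDensity κ x₀ u x *
        (1 / (coshGap x₀ x * (coshGap x₀ x + 2))) := by
    filter_upwards [hae] with x ⟨hx, hxy⟩
    have hg := coshGap_pos hx hy hxy
    rw [hρx hx hxy, Real.sinh_arcosh (by linarith), sq_sqrt_one_add_sq_sub_one hg,
      ← conf_mul_radialDeriv_sq hκ hx hy hxy]
    ring
  have e4 : (fun x => conf κ x ^ n * ((ρ x * ct κ (ρ x) - 1) / ρ x ^ 2
        * |radialDeriv κ x₀ u x| ^ 2))
      =ᵐ[volume.restrict (space n)] fun x => radialDensity κ x₀ u x *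
        (κ ^ 2 * (Real.arcosh (1 + coshGap x₀ x) * (1 + coshGap x₀ x) /
          √((1 + coshGap x₀ x) ^ 2 - 1) - 1) / Real.arcosh (1 + coshGap x₀ x) ^ 2) := by
    filter_upwards [hae] with x ⟨hx, hxy⟩
    have hg := coshGap_pos hx hy hxy
    have hψ := arcosh_one_add_pos hg
    have hS := sqrt_one_add_sq_sub_one_pos hg
    rw [ct, hρx hx hxy, Real.sinh_arcosh (by linarith), Real.cosh_arcosh (by linarith),
      ← conf_mul_radialDeriv_sq hκ hx hy hxy]
    rw [← hρx hx hxy] at hψ ⊢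
    have hρ0 : 0 < ρ x := pos_of_mul_pos_right hψ hκ.le
    field_simp
  have i1 := integrableOn_radialDensity_mul hκ hy hu hc hs (by omega) (k := fun _ => 1)
    continuousOn_const fun s hs => one_le_weight_bound hs
  have i2 := integrableOn_radialDensity_mul hκ hy hu hc hs (by omega)
    (continuousOn_inv_arcosh_sq (κ := κ)) fun s hs => inv_arcosh_sq_weight_bound hs
  have i3 := integrableOn_radialDensity_mul hκ hy hu hc hs (by omega)
    continuousOn_inv_sinh_sq fun s hs => inv_sinh_sq_weight_bound hs
  have i4 := integrableOn_radialDensity_mul hκ hy hu hc hs (by omega)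
    (continuousOn_coth_weight (κ := κ)) fun s hs => coth_weight_bound hs
  have i5 := integrableOn_laplaceBeltrami_sq hκ hu hc hs
  refine ⟨⟨(integrable_vol hκ ?_).integrableOn, (integrable_vol hκ (i1.congr e1.symm)).integrableOn,
    (integrable_vol hκ (i2.congr e2.symm)).integrableOn,
    (integrable_vol hκ (i3.congr e3.symm)).integrableOn,
    (integrable_vol hκ (i4.congr e4.symm)).integrableOn⟩, ?_⟩
  · simpa only [sq_abs] using i5
  rw [setIntegral_vol hκ fun x hx => by simp [hrad0 x hx],
    setIntegral_vol hκ fun x hx => by simp [hrad0 x hx],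
    setIntegral_vol hκ fun x hx => by simp [hrad0 x hx],
    setIntegral_vol hκ fun x hx => by simp [hrad0 x hx],
    setIntegral_vol hκ fun x hx => by simp [laplaceBeltrami_eq_zero κ fun h => hx (hsΩ h)],
    integral_congr_ae e1, integral_congr_ae e2, integral_congr_ae e3, integral_congr_ae e4,
    ← integral_const_mul, ← integral_const_mul, ← integral_const_mul, ← integral_const_mul,
    ← integral_add (i1.const_mul _) (i2.const_mul _),
    ← integral_add ((i1.const_mul _).fun_add (i2.const_mul _)) (i3.const_mul _),
    ← integral_add (((i1.const_mul _).fun_add (i2.const_mul _)).fun_add (i3.const_mul _))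
      (i4.const_mul _)]
  simp only [sq_abs]
  refine le_of_eq_of_le (integral_congr_ae ?_)
    (integral_radialDensity_mul_profileWeight_le hκ hy hu hc hs hn ha0 hh0)
  filter_upwards [hae] with x ⟨hx, hxy⟩
  -- With γ = 2h - 1, the constant ((n - 1)² - γ²)/4 is λ.
  rw [profileWeight_zero rfl (coshGap_pos hx hy hxy), ← hh, hγ2]
  ring
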